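/- A geometric graph on a finite point set in the plane is crossing-free if any two distinct edges (straight segments) meet at most in a common endpoint; a triangulation is an edge-maximal crossing-free geometric graph. A chain $C$ with $n$ chain edges is a sequence of points $p_0,\dots,p_n$ in $\mathbb{R}^2$ with strictly increasing $x$-coordinates, no three on a line, such that every chain edge $p_{i-1}p_i$ is contained in every triangulation of $\{p_0,\dots,p_n\}$. (For $n=0$ this is a single point.) The chain curve is the union of the chain edges. For $0\le i<j\le n$ put $V(C)_{i,j}=0$ if $j=i+1$, and otherwise $V(C)_{i,j}=+1$ or $-1$ according to whether $p_ip_j$ lies above or below the chain curve; in the case $+1$ we call $p_ip_j$ an upper edge. Chains with the same $V$ are regarded as equal. For chains $C_1,C_2$ with $n_1,n_2$ chain edges, the convex sum $C_1\vee C_2$ (respectively the concave sum $C_1\wedge C_2$) is the chain with $n_1+n_2$ chain edges whose entries are $V_{i,j}=V(C_1)_{i,j}$ for $j\le n_1$, $V_{i,j}=V(C_2)_{i-n_1,j-n_1}$ for $i\ge n_1$, and $V_{i,j}=+1$ (respectively $-1$) for $i<n_1<j$. The concave chain $\mathrm{Cave}_v$ is $E\wedge\dots\wedge E$ with $v$ copies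 of the chain $E$ with one chain edge (a single point if $v=0$). A partial upper triangulation of $C$ with $v$ visible edges is given by a curve $p_{i_0}p_{i_1}\cdots p_{i_v}$, $0=i_0<i_1<\dots<i_v=n$, composed of chain edges and upper edges only (the visible edges), and consists of all chain edges, all visible edges, and a triangulation of the areas between the chain curve and the curve of visible edges; that is, it is an edge-maximal graph among the crossing-free graphs all of whose edges are chain edges or upper edges that lie nowhere above the curve of visible edges. Its triangles are the triangles bounded by three of its edges. **Proposition.** Let $C_1$ and $C_2$ be chains with $n_1$ and $n_2$ chain edges. There is a triangle-preserving bijection between - all triples $(T_1,T_2,T_3)$ where $T_1$ is a partial upper triangulation of $C_1$ (with $v_1$ visible edges), $T_2$ is a partial upper triangulation of $C_2$ (with $v_2$ visible edges), and $T_3$ is a partial upper triangulation of $\mathrm{Cave}_{v_1}\vee \mathrm{Cave}_{v_2}$, and - all partial upper triangulations of $C_1\vee C_2$. Here triangle-preserving means the following. Regard the points of $C_1$ as the points $0,\dots,n_1$ and those of $C_2$ as the points $n_1,\dots,n_1+n_2$ of $C_1\vee C_2$, and regard the points $0,\dots,v_1+v_2$ of $\mathrm{Cave}_{v_1}\vee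 \mathrm{Cave}_{v_2}$ as the vertices, from left to right, of the visible curve of $T_1$ followed by that of $T_2$. Then the edge set and the set of triangles of the image of $(T_1,T_2,T_3)$ are the unions of the edge sets and of the sets of triangles of $T_1$, $T_2$ and $T_3$, and the number of triangles of the image is the sum of the numbers of triangles of $T_1$, $T_2$ and $T_3$. -/

import Mathlib

namespace ChainTri

/-! ### Points, orientation, crossing-free geometric graphs -/

/-- A geometric graph on the points `p 0, …, p n` is a graph on the indices, its edges being drawn as
straight segments. It is crossing-free if two distinct edges meet at most in a common endpoint. -/
def CrossingFree {n : ℕ} (p : Fin (n + 1) → ℝ × ℝ) (G : SimpleGraph (Fin (n + 1))) : Prop :=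
  ∀ a b c d, G.Adj a b → G.Adj c d → s(a, b) ≠ s(c, d) →
    ∀ z ∈ segment ℝ (p a) (p b) ∩ segment ℝ (p c) (p d),
      ∃ v, v ∈ s(a, b) ∧ v ∈ s(c, d) ∧ z = p v

/-- A triangulation of a point set: an edge-maximal crossing-free geometric graph. -/
def IsTriangulation {n : ℕ} (p : Fin (n + 1) → ℝ × ℝ) (G : SimpleGraph (Fin (n + 1))) : Prop :=
  Maximal (CrossingFree p) G

/-- A chain with `n` chain edges: points `p 0, …, p n` sorted by strictly increasing `x`-coordinate,
no three of them on a line, such that every edge between consecutive points is unavoidable, that is,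
contained in every triangulation of the point set. -/
structure Chain (n : ℕ) where
  pt : Fin (n + 1) → ℝ × ℝ
  strictMono_fst : StrictMono fun i => (pt i).1
  not_collinear : ∀ i j k, i < j → j < k → ¬ Collinear ℝ {pt i, pt j, pt k}
  unavoidable : ∀ G, IsTriangulation pt G → ∀ i : Fin n, G.Adj i.castSucc i.succ

namespace Chain

variable {n : ℕ}

/-- The chain curve, the union of all chain edges. -/
def curve (C : Chain n) : Set (ℝ × ℝ) :=
  ⋃ i : Fin n, segment ℝ (C.pt i.castSucc) (C.pt i.succ)

/-- The edge between `p i` and `p j` lies above the chain curve (except for its endpoints). -/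
def LiesAbove (C : Chain n) (i j : Fin (n + 1)) : Prop :=
  ∀ z ∈ openSegment ℝ (C.pt i) (C.pt j), ∀ w ∈ C.curve, w.1 = z.1 → w.2 < z.2

/-- The edge between `p i` and `p j` lies below the chain curve (except for its endpoints). -/
def LiesBelow (C : Chain n) (i j : Fin (n + 1)) : Prop :=
  ∀ z ∈ openSegment ℝ (C.pt i) (C.pt j), ∀ w ∈ C.curve, w.1 = z.1 → z.2 < w.2

open Classical in
/-- The visibility triangle; only the entries with `i < j` are meaningful. For such entries the last
`else` branch never occurs (see `vis_eq_one_or` below). -/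
noncomputable def vis (C : Chain n) (i j : Fin (n + 1)) : ℤ :=
  if (i : ℕ) + 1 = j then 0
  else if C.LiesAbove i j then 1
  else if C.LiesBelow i j then -1
  else 0

/-- Two chains are considered to be equal if their visibility triangles are identical. -/
instance : Setoid (Chain n) where
  r C D := ∀ i j, i < j → C.vis i j = D.vis i j
  iseqv := ⟨fun _ _ _ _ => rfl, fun h i j hij => (h i j hij).symm,
    fun h h' i j hij => (h i j hij).trans (h' i j hij)⟩

/-- `p i` and `p j` (with `i < j`) are joined by a chain edge. -/
def IsChainEdge (_C : Chain n) (i j : Fin (n + 1)) : Prop := (i : ℕ) + 1 = j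

/-- The edge from `p i` to `p j` (with `i < j`) is an upper edge. -/
def IsUpperEdge (C : Chain n) (i j : Fin (n + 1)) : Prop := i < j ∧ C.vis i j = 1

end Chain

/-! ### Convex and concave sums of chains -/

/-- The index in a sum of two chains of a point of the first summand. -/
def inl {n₁ n₂ : ℕ} (i : Fin (n₁ + 1)) : Fin (n₁ + n₂ + 1) := ⟨i, by omega⟩

/-- The index in a sum of two chains of a point of the second summand; the last point of the first
summand is the first point of the second one. -/
def inr {n₁ n₂ : ℕ} (j : Fin (n₂ + 1)) : Fin (n₁ + n₂ + 1) := ⟨n₁ + j, by omega⟩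

/-- `C` has the visibility triangle that contains those of `C₁` and `C₂`, and the entry `s` at all
edges from an earlier point of `C₁` to a later point of `C₂`. -/
def IsSum {n₁ n₂ : ℕ} (s : ℤ) (C₁ : Chain n₁) (C₂ : Chain n₂) (C : Chain (n₁ + n₂)) : Prop :=
  (∀ i j : Fin (n₁ + 1), i < j → C.vis (inl i) (inl j) = C₁.vis i j) ∧
  (∀ i j : Fin (n₂ + 1), i < j → C.vis (inr i) (inr j) = C₂.vis i j) ∧
  ∀ i j : Fin (n₁ + n₂ + 1), (i : ℕ) < n₁ → n₁ < (j : ℕ) → C.vis i j = s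

/-! ### Existence of the sums

The facts in this section serve only to show that the two sums exist. -/

/-- Twice the signed area of a triangle. -/
def orient (a b c : ℝ × ℝ) : ℝ := (b.1 - a.1) * (c.2 - a.2) - (b.2 - a.2) * (c.1 - a.1)

theorem collinear_iff_orient {a b c : ℝ × ℝ} (h : a.1 < c.1) :
    Collinear ℝ {a, b, c} ↔ orient a b c = 0 := by
  have hne : c.1 - a.1 ≠ 0 := by linarith
  rw [collinear_iff_of_mem (p₀ := a) (by simp)]
  constructor
  · rintro ⟨v, hv⟩
    obtain ⟨r, rfl⟩ := hv b (by simp)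
    obtain ⟨r', rfl⟩ := hv c (by simp)
    simp [orient]
    ring
  · intro ho
    refine ⟨c - a, fun p hp => ?_⟩
    simp only [Set.mem_insert_iff, Set.mem_singleton_iff] at hp
    rcases hp with rfl | rfl | rfl
    · exact ⟨0, by simp⟩
    · refine ⟨(p.1 - a.1) / (c.1 - a.1), ?_⟩
      ext
      · simp
        field_simp
        ring
      · simp
        field_simp
        unfold orient at ho
        linarith
    · exact ⟨1, by simp⟩

theorem mem_segment_prod {a b z : ℝ × ℝ} : z ∈ segment ℝ a b ↔
    ∃ t : ℝ, 0 ≤ t ∧ t ≤ 1 ∧ z.1 = (1 - t) * a.1 + t * b.1 ∧ z.2 = (1 - t) * a.2 + t * b.2 := by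
  constructor
  · rintro ⟨u, t, hu, ht, hut, rfl⟩
    obtain rfl : u = 1 - t := by linarith
    exact ⟨t, ht, by linarith, by simp, by simp⟩
  · rintro ⟨t, h0, h1, e1, e2⟩
    refine ⟨1 - t, t, by linarith, h0, by ring, ?_⟩
    ext
    · simp [e1]
    · simp [e2]

theorem mem_openSegment_prod {a b z : ℝ × ℝ} : z ∈ openSegment ℝ a b ↔
    ∃ t : ℝ, 0 < t ∧ t < 1 ∧ z.1 = (1 - t) * a.1 + t * b.1 ∧ z.2 = (1 - t) * a.2 + t * b.2 := by
  constructor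
  · rintro ⟨u, t, hu, ht, hut, rfl⟩
    obtain rfl : u = 1 - t := by linarith
    exact ⟨t, ht, by linarith, by simp, by simp⟩
  · rintro ⟨t, h0, h1, e1, e2⟩
    refine ⟨1 - t, t, by linarith, h0, by ring, ?_⟩
    ext
    · simp [e1]
    · simp [e2]

/-- A point on the line of `a c` whose `x`-coordinate is between those of `a` and `c`. -/
theorem mem_segment_of_orient {a c z : ℝ × ℝ} (hac : a.1 < c.1) (h1 : a.1 ≤ z.1) (h2 : z.1 ≤ c.1)
    (ho : orient a z c = 0) : z ∈ segment ℝ a c := by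
  have hne : 0 < c.1 - a.1 := by linarith
  refine mem_segment_prod.2 ⟨(z.1 - a.1) / (c.1 - a.1), by apply div_nonneg <;> linarith,
    by rw [div_le_one hne]; linarith, ?_, ?_⟩
  · field_simp
    ring
  · field_simp
    unfold orient at ho
    linarith

theorem orient_of_mem_segment {a c z : ℝ × ℝ} (h : z ∈ segment ℝ a c) : orient a z c = 0 := by
  obtain ⟨t, -, -, e1, e2⟩ := mem_segment_prod.1 h
  simp only [orient, e1, e2]
  ring

theorem orient_lerp {a c u v w : ℝ × ℝ} {t : ℝ} (e1 : w.1 = (1 - t) * u.1 + t * v.1)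
    (e2 : w.2 = (1 - t) * u.2 + t * v.2) :
    orient a w c = (1 - t) * orient a u c + t * orient a v c := by
  simp only [orient, e1, e2]
  ring

@[simp] theorem orient_left (a c : ℝ × ℝ) : orient a a c = 0 := by simp [orient]

@[simp] theorem orient_right (a c : ℝ × ℝ) : orient a c c = 0 := by simp only [orient]; ring

/-- For all edges, the points in between are on the same side. -/
def Consistent {n : ℕ} (p : Fin (n + 1) → ℝ × ℝ) : Prop :=
  ∀ i j j' k, i < j → j < k → i < j' → j' < k →
    0 < orient (p i) (p j) (p k) * orient (p i) (p j') (p k)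

namespace Chain

variable {n : ℕ}

theorem orient_ne_zero (C : Chain n) {i j k : Fin (n + 1)} (hij : i < j) (hjk : j < k) :
    orient (C.pt i) (C.pt j) (C.pt k) ≠ 0 := fun h =>
  C.not_collinear i j k hij hjk
    ((collinear_iff_orient (C.strictMono_fst (hij.trans hjk))).2 h)

/-- A chain edge is crossed by no other edge. -/
theorem not_crossed (C : Chain n) (l : Fin n) {a b : Fin (n + 1)} (hab : a < b)
    (hne : s(l.castSucc, l.succ) ≠ s(a, b)) {z : ℝ × ℝ}
    (hz : z ∈ segment ℝ (C.pt l.castSucc) (C.pt l.succ))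
    (hz' : z ∈ segment ℝ (C.pt a) (C.pt b)) :
    ∃ v, v ∈ s(l.castSucc, l.succ) ∧ v ∈ s(a, b) ∧ z = C.pt v := by
  have hcf : CrossingFree C.pt (SimpleGraph.edge a b) := by
    intro c d e f h1 h2 h3
    rw [SimpleGraph.edge_adj] at h1 h2
    exfalso
    apply h3
    rcases h1.1 with ⟨rfl, rfl⟩ | ⟨rfl, rfl⟩ <;> rcases h2.1 with ⟨rfl, rfl⟩ | ⟨rfl, rfl⟩ <;>
      simp [Sym2.eq_swap]
  obtain ⟨G, hG, hmax⟩ := Finite.exists_le_maximal hcf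
  have h1 : G.Adj a b := hG (by simp [SimpleGraph.edge_adj, hab.ne])
  exact hmax.prop _ _ _ _ (C.unavoidable G hmax l) h1 hne z ⟨hz, hz'⟩

theorem consistent_step (C : Chain n) (l : Fin n) {i k : Fin (n + 1)} (h1 : i < l.castSucc)
    (h2 : l.succ < k) (h3 : orient (C.pt i) (C.pt l.castSucc) (C.pt k) *
      orient (C.pt i) (C.pt l.succ) (C.pt k) < 0) : False := by
  set u := orient (C.pt i) (C.pt l.castSucc) (C.pt k) with hu
  set v := orient (C.pt i) (C.pt l.succ) (C.pt k) with hv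
  have hl : l.castSucc < l.succ := Fin.castSucc_lt_succ
  have hil := C.strictMono_fst h1
  have hlk := C.strictMono_fst h2
  have hll := C.strictMono_fst hl
  simp only at hil hlk hll
  have hu0 : u ≠ 0 := fun h => by simp [h] at h3
  have hv0 : v ≠ 0 := fun h => by simp [h] at h3
  have huv : u - v ≠ 0 := fun h => by
    rw [sub_eq_zero.1 h] at h3
    nlinarith [mul_self_nonneg v]
  have ht0 : 0 < u / (u - v) := by
    rcases mul_neg_iff.1 h3 with h | h
    · exact div_pos h.1 (by linarith [h.2])
    · exact div_pos_of_neg_of_neg h.1 (by linarith [h.2])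
  have ht1 : u / (u - v) < 1 := by
    have : 0 < 1 - u / (u - v) := by
      have e : 1 - u / (u - v) = (-v) / (u - v) := by field_simp; ring
      rw [e]
      rcases mul_neg_iff.1 h3 with h | h
      · exact div_pos (by linarith [h.2]) (by linarith [h.1, h.2])
      · exact div_pos_of_neg_of_neg (by linarith [h.2]) (by linarith [h.1, h.2])
    linarith
  set t := u / (u - v) with ht
  let z : ℝ × ℝ := ((1 - t) * (C.pt l.castSucc).1 + t * (C.pt l.succ).1,
    (1 - t) * (C.pt l.castSucc).2 + t * (C.pt l.succ).2)
  have hz : z ∈ segment ℝ (C.pt l.castSucc) (C.pt l.succ) :=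
    mem_segment_prod.2 ⟨t, ht0.le, ht1.le, rfl, rfl⟩
  have hz1 : (C.pt l.castSucc).1 ≤ z.1 := by
    have := mul_pos ht0 (sub_pos.2 hll)
    simp only [z]
    linarith
  have hz2 : z.1 ≤ (C.pt l.succ).1 := by
    have := mul_pos (sub_pos.2 ht1) (sub_pos.2 hll)
    simp only [z]
    linarith
  have hzo : orient (C.pt i) z (C.pt k) = 0 := by
    rw [orient_lerp (t := t) (u := C.pt l.castSucc) (v := C.pt l.succ) rfl rfl, ← hu, ← hv, ht]
    field_simp
    ring
  have hz' : z ∈ segment ℝ (C.pt i) (C.pt k) :=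
    mem_segment_of_orient (hil.trans (hll.trans hlk)) (by linarith) (by linarith) hzo
  obtain ⟨w, hw1, hw2, -⟩ := C.not_crossed l (h1.trans (hl.trans h2)) (by
    intro h
    rw [Sym2.eq_iff] at h
    rcases h with h | h
    · exact h1.ne h.1.symm
    · exact (hl.trans h2).ne h.1) hz hz'
  rw [Sym2.mem_iff] at hw1 hw2
  rcases hw1 with rfl | rfl <;> rcases hw2 with h | h
  · exact h1.ne h.symm
  · exact (hl.trans h2).ne h
  · exact (h1.trans hl).ne h.symm
  · exact h2.ne h

theorem consistent_aux (C : Chain n) {i k : Fin (n + 1)} (d : ℕ) :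
    ∀ j j' : Fin (n + 1), i < j → j < k → i < j' → j' < k → (j' : ℕ) = j + d →
      0 < orient (C.pt i) (C.pt j) (C.pt k) * orient (C.pt i) (C.pt j') (C.pt k) := by
  induction d with
  | zero =>
    intro j j' h1 h2 _ _ h
    obtain rfl : j' = j := Fin.ext (by simpa using h)
    exact mul_self_pos.2 (C.orient_ne_zero h1 h2)
  | succ d ih =>
    intro j j' h1 h2 h3 h4 h
    have hj' : (j : ℕ) + d < n := by omega
    let l : Fin n := ⟨j + d, hj'⟩
    have e : j' = l.succ := Fin.ext (by simp [l]; omega)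
    have h5 : i < l.castSucc := by
      rw [Fin.lt_def] at h1 ⊢
      simp [l]; omega
    have h6 : l.castSucc < k := by
      rw [Fin.lt_def] at h4 ⊢
      simp [l]; omega
    have h7 := ih j l.castSucc h1 h2 h5 h6 (by simp [l])
    have h8 : ¬ (orient (C.pt i) (C.pt l.castSucc) (C.pt k) *
      orient (C.pt i) (C.pt j') (C.pt k) < 0) := fun h => by
      rw [e] at h
      exact C.consistent_step l h5 (e ▸ h4) h
    have h9 := C.orient_ne_zero h3 h4
    have h10 := C.orient_ne_zero h5 h6
    have h11 := lt_of_le_of_ne (not_lt.1 h8) (mul_ne_zero h10 h9).symm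
    rcases pos_and_pos_or_neg_and_neg_of_mul_pos h7 with h | h <;>
      rcases pos_and_pos_or_neg_and_neg_of_mul_pos h11 with h' | h'
    · exact mul_pos h.1 h'.2
    · exact absurd h.2 (by linarith [h'.1])
    · exact absurd h.2 (by linarith [h'.1])
    · exact mul_pos_of_neg_of_neg h.1 h'.2

theorem consistent (C : Chain n) : Consistent C.pt := by
  intro i j j' k h1 h2 h3 h4
  rcases le_total j j' with h | h
  · exact C.consistent_aux (j' - j : ℕ) j j' h1 h2 h3 h4 (by rw [Fin.le_def] at h; omega)
  · rw [mul_comm]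
    exact C.consistent_aux (j - j' : ℕ) j' j h3 h4 h1 h2 (by rw [Fin.le_def] at h; omega)

theorem vis_aux (C : Chain n) (s : ℝ) {i k : Fin (n + 1)} (hik : (i : ℕ) + 1 < k)
    (hs : ∀ j, i < j → j < k → 0 < s * orient (C.pt i) (C.pt j) (C.pt k)) :
    ∀ z ∈ openSegment ℝ (C.pt i) (C.pt k), ∀ w ∈ C.curve, w.1 = z.1 → 0 < s * (z.2 - w.2) := by
  intro z hz w hw hwz
  obtain ⟨r, hr0, hr1, er1, er2⟩ := mem_openSegment_prod.1 hz
  have hx := C.strictMono_fst (show i < k by rw [Fin.lt_def]; omega)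
  simp only at hx
  have hxi : (C.pt i).1 < w.1 := by nlinarith [mul_pos hr0 (sub_pos.2 hx)]
  have hxk : w.1 < (C.pt k).1 := by nlinarith [mul_pos (sub_pos.2 hr1) (sub_pos.2 hx)]
  simp only [curve, Set.mem_iUnion] at hw
  obtain ⟨l, hl⟩ := hw
  obtain ⟨t, ht0, ht1, e1, e2⟩ := mem_segment_prod.1 hl
  have hll := C.strictMono_fst (Fin.castSucc_lt_succ : l.castSucc < l.succ)
  simp only at hll
  have hl1 : (C.pt l.castSucc).1 ≤ w.1 := by nlinarith [mul_nonneg ht0 (sub_pos.2 hll).le]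
  have hl2 : w.1 ≤ (C.pt l.succ).1 := by nlinarith [mul_nonneg (sub_nonneg.2 ht1) (sub_pos.2 hll).le]
  have hlk : l.castSucc < k := C.strictMono_fst.lt_iff_lt.1 (by simpa using hl1.trans_lt hxk)
  have hil : i < l.succ := C.strictMono_fst.lt_iff_lt.1 (by simpa using hxi.trans_le hl2)
  have key : 0 < s * orient (C.pt i) w (C.pt k) := by
    rw [orient_lerp e1 e2]
    rw [Fin.lt_def] at hlk hil
    simp only [Fin.val_castSucc, Fin.val_succ] at hlk hil
    by_cases c1 : i = l.castSucc
    · have : t ≠ 0 := by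
        rintro rfl
        rw [← c1] at e1
        linarith
      have ht : 0 < t := lt_of_le_of_ne ht0 this.symm
      have c1' : (i : ℕ) = l := by simpa using congrArg Fin.val c1
      have := hs l.succ (by rw [Fin.lt_def]; simp; omega) (by rw [Fin.lt_def]; simp; omega)
      rw [← c1, orient_left]
      nlinarith [mul_pos ht this]
    · have c1' : (i : ℕ) ≠ l := fun h => c1 (Fin.ext (by simpa using h))
      have p1 := hs l.castSucc (by rw [Fin.lt_def]; simp; omega) (by rw [Fin.lt_def]; simp; omega)
      by_cases c2 : k = l.succ
      · have : t ≠ 1 := by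
          rintro rfl
          rw [← c2] at e1
          linarith
        have ht : 0 < 1 - t := sub_pos.2 (lt_of_le_of_ne ht1 this)
        rw [← c2, orient_right]
        nlinarith [mul_pos ht p1]
      · have c2' : (k : ℕ) ≠ l + 1 := fun h => c2 (Fin.ext (by simpa using h))
        have p2 := hs l.succ (by rw [Fin.lt_def]; simp; omega) (by rw [Fin.lt_def]; simp; omega)
        rcases ht0.eq_or_lt with h | h
        · subst h
          simpa using p1
        · nlinarith [mul_pos h p2, mul_nonneg (sub_nonneg.2 ht1) p1.le]
  have e : orient (C.pt i) w (C.pt k) = (z.2 - w.2) * ((C.pt k).1 - (C.pt i).1) := by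
    have hz0 : orient (C.pt i) z (C.pt k) = 0 :=
      orient_of_mem_segment (openSegment_subset_segment _ _ _ hz)
    have : orient (C.pt i) w (C.pt k) - orient (C.pt i) z (C.pt k) =
        (z.2 - w.2) * ((C.pt k).1 - (C.pt i).1) := by
      simp only [orient, hwz]
      ring
    linarith
  rw [e, ← mul_assoc] at key
  exact pos_of_mul_pos_left key (sub_pos.2 hx).le

/-- The visibility triangle in terms of orientations. -/
theorem vis_eq (C : Chain n) {i j k : Fin (n + 1)} (hij : i < j) (hjk : j < k) :
    (0 < orient (C.pt i) (C.pt j) (C.pt k) → C.vis i k = 1) ∧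
    (orient (C.pt i) (C.pt j) (C.pt k) < 0 → C.vis i k = -1) := by
  have hik : (i : ℕ) + 1 < k := by
    rw [Fin.lt_def] at hij hjk
    omega
  constructor
  · intro h
    have hab : C.LiesAbove i k := fun z hz w hw e => by
      have := C.vis_aux 1 hik (fun j' h1 h2 => by
        have := C.consistent i j j' k hij hjk h1 h2
        rw [one_mul]
        exact (pos_iff_pos_of_mul_pos this).1 h) z hz w hw e
      linarith
    rw [vis, if_neg hik.ne, if_pos hab]
  · intro h
    have hbe : C.LiesBelow i k := fun z hz w hw e => by
      have := C.vis_aux (-1) hik (fun j' h1 h2 => by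
        have := C.consistent i j j' k hij hjk h1 h2
        linarith [(neg_iff_neg_of_mul_pos this).1 h]) z hz w hw e
      linarith
    have hab : ¬ C.LiesAbove i k := fun hab => by
      have h1 := C.strictMono_fst hij
      have h2 := C.strictMono_fst hjk
      simp only at h1 h2
      have hne : 0 < (C.pt k).1 - (C.pt i).1 := by linarith
      let t := ((C.pt j).1 - (C.pt i).1) / ((C.pt k).1 - (C.pt i).1)
      let z : ℝ × ℝ := ((1 - t) * (C.pt i).1 + t * (C.pt k).1,
        (1 - t) * (C.pt i).2 + t * (C.pt k).2)
      have hz : z ∈ openSegment ℝ (C.pt i) (C.pt k) := mem_openSegment_prod.2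
        ⟨t, div_pos (by linarith) hne, (div_lt_one hne).2 (by linarith), rfl, rfl⟩
      have hj : C.pt j ∈ C.curve := by
        have hj0 : (j : ℕ) < n := by
          rw [Fin.lt_def] at hjk
          omega
        exact Set.mem_iUnion.2 ⟨⟨j, hj0⟩, left_mem_segment ℝ _ _⟩
      have hx : (C.pt j).1 = z.1 := by
        simp only [z, t]
        field_simp
        ring
      have := hab z hz _ hj hx
      have := hbe z hz _ hj hx
      linarith
    rw [vis, if_neg hik.ne, if_neg hab, if_pos hbe]

/-- Every entry outside the diagonal of chain edges is `1` or `-1`. -/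
theorem vis_eq_one_or (C : Chain n) {i k : Fin (n + 1)} (hik : (i : ℕ) + 1 < k) :
    C.vis i k = 1 ∨ C.vis i k = -1 := by
  let j : Fin (n + 1) := ⟨i + 1, by omega⟩
  have h1 : i < j := by rw [Fin.lt_def]; simp [j]
  have h2 : j < k := by rw [Fin.lt_def]; simpa [j] using hik
  rcases (C.orient_ne_zero h1 h2).lt_or_gt with h | h
  · exact Or.inr ((C.vis_eq h1 h2).2 h)
  · exact Or.inl ((C.vis_eq h1 h2).1 h)

theorem exists_of_consistent (p : Fin (n + 1) → ℝ × ℝ) (hp : StrictMono fun i => (p i).1)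
    (hc : Consistent p) : ∃ C : Chain n, C.pt = p := by
  have hne : ∀ i j k, i < j → j < k → orient (p i) (p j) (p k) ≠ 0 := fun i j k h1 h2 h => by
    have := hc i j j k h1 h2 h1 h2
    simp [h] at this
  have nocross : ∀ (l : Fin n) (a b : Fin (n + 1)), a < b →
      s(l.castSucc, l.succ) ≠ s(a, b) → ∀ z, z ∈ segment ℝ (p l.castSucc) (p l.succ) →
      z ∈ segment ℝ (p a) (p b) → ∃ v, v ∈ s(l.castSucc, l.succ) ∧ v ∈ s(a, b) ∧ z = p v := by
    intro l a b hab hs z hz hz'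
    have hll := hp (Fin.castSucc_lt_succ : l.castSucc < l.succ)
    have hxab := hp hab
    simp only at hll hxab
    obtain ⟨t, ht0, ht1, e1, e2⟩ := mem_segment_prod.1 hz
    obtain ⟨r, hr0, hr1, f1, f2⟩ := mem_segment_prod.1 hz'
    have m1 := mul_nonneg ht0 (sub_pos.2 hll).le
    have m2 := mul_nonneg (sub_nonneg.2 ht1) (sub_pos.2 hll).le
    have m3 := mul_nonneg hr0 (sub_pos.2 hxab).le
    have m4 := mul_nonneg (sub_nonneg.2 hr1) (sub_pos.2 hxab).le
    have zc : t = 0 → z = p l.castSucc := by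
      rintro rfl
      ext
      · simpa using e1
      · simpa using e2
    have zs : t = 1 → z = p l.succ := by
      rintro rfl
      ext
      · simpa using e1
      · simpa using e2
    rcases le_or_gt l.succ a with h | h
    · have hx : (p l.succ).1 ≤ (p a).1 := hp.monotone h
      have hxa : (p l.succ).1 = (p a).1 := by linarith
      have hla : l.succ = a := hp.injective hxa
      have : t = 1 := by
        have : (1 - t) * ((p l.succ).1 - (p l.castSucc).1) = 0 := by linarith
        rcases mul_eq_zero.1 this with h | h <;> linarith
      exact ⟨l.succ, by simp, by simp [hla], zs this⟩
    rcases le_or_gt b l.castSucc with h' | h'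
    · have hx : (p b).1 ≤ (p l.castSucc).1 := hp.monotone h'
      have hxa : (p b).1 = (p l.castSucc).1 := by linarith
      have hla : b = l.castSucc := hp.injective hxa
      have : t = 0 := by
        have : t * ((p l.succ).1 - (p l.castSucc).1) = 0 := by linarith
        rcases mul_eq_zero.1 this with h | h <;> linarith
      exact ⟨l.castSucc, by simp, by simp [hla], zc this⟩
    have hz0 : orient (p a) z (p b) = 0 := orient_of_mem_segment hz'
    rw [orient_lerp e1 e2] at hz0
    rw [Fin.lt_def] at h h'
    simp only [Fin.val_castSucc, Fin.val_succ] at h h'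
    by_cases c1 : a = l.castSucc
    · have c1' : (a : ℕ) = l := by simpa using congrArg Fin.val c1
      have c2 : b ≠ l.succ := fun c2 => hs (by rw [c1, c2])
      have c2' : (b : ℕ) ≠ l + 1 := fun h => c2 (Fin.ext (by simpa using h))
      have := hne a l.succ b (by rw [Fin.lt_def]; simp; omega) (by rw [Fin.lt_def]; simp; omega)
      rw [← c1, orient_left] at hz0
      have ht : t = 0 := by simpa [this] using hz0
      exact ⟨l.castSucc, by simp, by simp [c1], zc ht⟩
    · have c1' : (a : ℕ) ≠ l := fun h => c1 (Fin.ext (by simpa using h))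
      have l1 : a < l.castSucc := by rw [Fin.lt_def]; simp; omega
      have l2 : l.castSucc < b := by rw [Fin.lt_def]; simp; omega
      have hn := hne a l.castSucc b l1 l2
      by_cases c2 : b = l.succ
      · rw [← c2, orient_right] at hz0
        have ht : 1 - t = 0 := by simpa [hn] using hz0
        exact ⟨l.succ, by simp, by simp [c2], zs (by linarith)⟩
      · exfalso
        have c2' : (b : ℕ) ≠ l + 1 := fun h => c2 (Fin.ext (by simpa using h))
        have hcc := hc a l.castSucc l.succ b l1 l2 (by rw [Fin.lt_def]; simp; omega)
          (by rw [Fin.lt_def]; simp; omega)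
        rcases ht0.eq_or_lt with ht | ht
        · subst ht
          simp [hn] at hz0
        · rcases pos_and_pos_or_neg_and_neg_of_mul_pos hcc with q | q
          · nlinarith [mul_pos ht q.2, mul_nonneg (sub_nonneg.2 ht1) q.1.le]
          · nlinarith [mul_pos ht (neg_pos.2 q.2),
              mul_nonneg (sub_nonneg.2 ht1) (neg_pos.2 q.1).le]
  have nocross' : ∀ (l : Fin n) (a b : Fin (n + 1)), a ≠ b →
      s(l.castSucc, l.succ) ≠ s(a, b) → ∀ z, z ∈ segment ℝ (p l.castSucc) (p l.succ) →
      z ∈ segment ℝ (p a) (p b) →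
        ∃ v, v ∈ s(l.castSucc, l.succ) ∧ v ∈ s(a, b) ∧ z = p v := by
    intro l a b hab hs z hz hz'
    rcases hab.lt_or_gt with h | h
    · exact nocross l a b h hs z hz hz'
    · rw [Sym2.eq_swap (a := a)] at hs ⊢
      rw [segment_symm] at hz'
      exact nocross l b a h hs z hz hz'
  refine ⟨⟨p, hp, fun i j k h1 h2 h => hne i j k h1 h2
    ((collinear_iff_orient (hp (h1.trans h2))).1 h), fun G hG l => ?_⟩, rfl⟩
  have hcf : CrossingFree p (G ⊔ SimpleGraph.edge l.castSucc l.succ) := by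
    intro a b c d h1 h2 hs z hz
    have hedge : ∀ a b, (SimpleGraph.edge l.castSucc l.succ).Adj a b →
        s(a, b) = s(l.castSucc, l.succ) ∧
          segment ℝ (p a) (p b) = segment ℝ (p l.castSucc) (p l.succ) := by
      intro a b h
      rw [SimpleGraph.edge_adj] at h
      rcases h.1 with ⟨rfl, rfl⟩ | ⟨rfl, rfl⟩
      · exact ⟨rfl, rfl⟩
      · exact ⟨Sym2.eq_swap, segment_symm _ _ _⟩
    rw [SimpleGraph.sup_adj] at h1 h2
    rcases h1 with h1 | h1
    · rcases h2 with h2 | h2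
      · exact hG.prop a b c d h1 h2 hs z hz
      · obtain ⟨e1, e2⟩ := hedge c d h2
        rw [e1] at hs ⊢
        rw [e2] at hz
        obtain ⟨v, q1, q2, q3⟩ := nocross' l a b h1.ne (Ne.symm hs) z hz.2 hz.1
        exact ⟨v, q2, q1, q3⟩
    · obtain ⟨e1, e2⟩ := hedge a b h1
      rw [e1] at hs ⊢
      rw [e2] at hz
      have hcd : c ≠ d := h2.elim (fun h => h.ne) (fun h => h.ne)
      exact nocross' l c d hcd hs z hz.1 hz.2
  have hle := hG.le_of_ge hcf le_sup_left
  apply hle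
  rw [SimpleGraph.sup_adj]
  right
  simp [SimpleGraph.edge_adj, (Fin.castSucc_lt_succ : l.castSucc < l.succ).ne]

end Chain

/-- Position of the points of the first summand: flattened by `ε`, ending at the origin, slope `-s`. -/
def leftMap (s ε : ℝ) (e q : ℝ × ℝ) : ℝ × ℝ := (q.1 - e.1, ε * (q.2 - e.2) - s * (q.1 - e.1))

/-- The points `leftMap s ε e (p i)` followed by the points `leftMap (-s) ε e' (p' j)`, where `e` is
the last point of the first sequence and `e'` the first point of the second one. -/
def sumPt {n₁ n₂ : ℕ} (s ε : ℝ) (p : Fin (n₁ + 1) → ℝ × ℝ) (p' : Fin (n₂ + 1) → ℝ × ℝ)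
    (l : Fin (n₁ + n₂ + 1)) : ℝ × ℝ :=
  if h : (l : ℕ) ≤ n₁ then leftMap s ε (p (Fin.last n₁)) (p ⟨l, by omega⟩)
  else leftMap (-s) ε (p' 0) (p' ⟨l - n₁, by omega⟩)

theorem sumPt_inl {n₁ n₂ : ℕ} (s ε : ℝ) (p : Fin (n₁ + 1) → ℝ × ℝ) (p' : Fin (n₂ + 1) → ℝ × ℝ)
    (i : Fin (n₁ + 1)) : sumPt s ε p p' (inl i) = leftMap s ε (p (Fin.last n₁)) (p i) := by
  have : ((inl i : Fin (n₁ + n₂ + 1)) : ℕ) ≤ n₁ := by simp [inl]; omega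
  rw [sumPt, dif_pos this]
  rfl

theorem sumPt_inr {n₁ n₂ : ℕ} (s ε : ℝ) (p : Fin (n₁ + 1) → ℝ × ℝ) (p' : Fin (n₂ + 1) → ℝ × ℝ)
    (j : Fin (n₂ + 1)) : sumPt s ε p p' (inr j) = leftMap (-s) ε (p' 0) (p' j) := by
  by_cases h : (j : ℕ) = 0
  · obtain rfl : j = 0 := Fin.ext h
    have : ((inr 0 : Fin (n₁ + n₂ + 1)) : ℕ) ≤ n₁ := by simp [inr]
    have e : ∀ h, (⟨((inr 0 : Fin (n₁ + n₂ + 1)) : ℕ), h⟩ : Fin (n₁ + 1)) = Fin.last n₁ :=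
      fun _ => Fin.ext (by simp [inr])
    rw [sumPt, dif_pos this, e]
    simp [leftMap]
  · have : ¬ ((inr j : Fin (n₁ + n₂ + 1)) : ℕ) ≤ n₁ := by
      show ¬ (n₁ + (j : ℕ) ≤ n₁)
      omega
    have e : ∀ h, (⟨((inr j : Fin (n₁ + n₂ + 1)) : ℕ) - n₁, h⟩ : Fin (n₂ + 1)) = j :=
      fun _ => Fin.ext (by simp [inr])
    rw [sumPt, dif_neg this, e]

theorem orient_leftMap (s ε : ℝ) (e a b c : ℝ × ℝ) :
    orient (leftMap s ε e a) (leftMap s ε e b) (leftMap s ε e c) = ε * orient a b c := by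
  simp only [orient, leftMap]
  ring

theorem exists_isSum {n₁ n₂ : ℕ} (s : ℤ) (hs : s = 1 ∨ s = -1) (C₁ : Chain n₁) (C₂ : Chain n₂) :
    ∃ C, IsSum s C₁ C₂ C := by
  -- bridging edges have the right orientation if `ε` is small
  have hlim : ∀ F : ℝ → ℝ, Continuous F → 0 < F 0 → ∀ᶠ ε in nhdsWithin (0 : ℝ) (Set.Ioi 0), 0 < F ε :=
    fun F hF h0 => nhdsWithin_le_nhds (hF.continuousAt.eventually (lt_mem_nhds h0))
  have hss : (s : ℝ) * s = 1 := by rcases hs with rfl | rfl <;> norm_num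
  set e₁ := C₁.pt (Fin.last n₁) with he₁
  set e₂ := C₂.pt 0 with he₂
  have h1 : ∀ᶠ ε in nhdsWithin (0 : ℝ) (Set.Ioi 0), ∀ (a b : Fin (n₁ + 1)) (c : Fin (n₂ + 1)),
      a < b → 0 < c → 0 < s * orient (leftMap s ε e₁ (C₁.pt a)) (leftMap s ε e₁ (C₁.pt b))
        (leftMap (-s) ε e₂ (C₂.pt c)) := by
    simp only [Filter.eventually_all]
    intro a b c hab hc
    apply hlim
    · simp only [orient, leftMap]
      fun_prop
    · have x1 := C₁.strictMono_fst hab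
      have x2 := C₂.strictMono_fst hc
      simp only at x1 x2
      have := mul_pos (sub_pos.2 x1) (sub_pos.2 x2)
      simp only [orient, leftMap, he₂]
      nlinarith
  have h2 : ∀ᶠ ε in nhdsWithin (0 : ℝ) (Set.Ioi 0), ∀ (a : Fin (n₁ + 1)) (b c : Fin (n₂ + 1)),
      a < Fin.last n₁ → b < c → 0 < s * orient (leftMap s ε e₁ (C₁.pt a))
        (leftMap (-s) ε e₂ (C₂.pt b)) (leftMap (-s) ε e₂ (C₂.pt c)) := by
    simp only [Filter.eventually_all]
    intro a b c ha hbc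
    apply hlim
    · simp only [orient, leftMap]
      fun_prop
    · have x1 := C₁.strictMono_fst ha
      have x2 := C₂.strictMono_fst hbc
      simp only at x1 x2
      have := mul_pos (sub_pos.2 x1) (sub_pos.2 x2)
      simp only [orient, leftMap, he₁]
      nlinarith
  obtain ⟨ε, ⟨h1, h2⟩, hε⟩ := ((h1.and h2).and self_mem_nhdsWithin).exists
  replace hε : 0 < ε := hε
  set p := sumPt (n₁ := n₁) (n₂ := n₂) s ε C₁.pt C₂.pt with hp
  have pl : ∀ i, p (inl i) = leftMap s ε e₁ (C₁.pt i) := sumPt_inl _ _ _ _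
  have pr : ∀ i, p (inr i) = leftMap (-s) ε e₂ (C₂.pt i) := sumPt_inr _ _ _ _
  have el : ∀ l : Fin (n₁ + n₂ + 1), (l : ℕ) ≤ n₁ → ∃ i : Fin (n₁ + 1), l = inl i :=
    fun l hl => ⟨⟨l, by omega⟩, rfl⟩
  have er : ∀ l : Fin (n₁ + n₂ + 1), n₁ ≤ (l : ℕ) → ∃ i : Fin (n₂ + 1), l = inr i :=
    fun l hl => ⟨⟨l - n₁, by omega⟩, Fin.ext (by simp [inr]; omega)⟩
  have ll : ∀ i j : Fin (n₁ + 1), (inl i : Fin (n₁ + n₂ + 1)) < inl j ↔ i < j := fun i j => Iff.rfl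
  have lr : ∀ i j : Fin (n₂ + 1), (inr i : Fin (n₁ + n₂ + 1)) < inr j ↔ i < j := fun i j => by
    rw [Fin.lt_def, Fin.lt_def]
    simp [inr]
  have ol : ∀ i j k : Fin (n₁ + 1), orient (p (inl i)) (p (inl j)) (p (inl k)) =
      ε * orient (C₁.pt i) (C₁.pt j) (C₁.pt k) := fun i j k => by
    rw [pl, pl, pl, orient_leftMap]
  have or' : ∀ i j k : Fin (n₂ + 1), orient (p (inr i)) (p (inr j)) (p (inr k)) =
      ε * orient (C₂.pt i) (C₂.pt j) (C₂.pt k) := fun i j k => by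
    rw [pr, pr, pr, orient_leftMap]
  have om : ∀ i j k : Fin (n₁ + n₂ + 1), (i : ℕ) < n₁ → n₁ < (k : ℕ) → i < j → j < k →
      0 < s * orient (p i) (p j) (p k) := by
    intro i j k hi hk hij hjk
    obtain ⟨a, rfl⟩ := el i hi.le
    obtain ⟨c, rfl⟩ := er k hk.le
    rcases le_total (j : ℕ) n₁ with hj | hj
    · obtain ⟨b, rfl⟩ := el j hj
      rw [pl, pl, pr]
      refine h1 a b c hij ?_
      simp only [inr] at hk
      rw [Fin.lt_def, Fin.val_zero]
      omega
    · obtain ⟨b, rfl⟩ := er j hj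
      rw [pl, pr, pr]
      exact h2 a b c (by rw [Fin.lt_def]; simpa [inl] using hi) ((lr b c).1 hjk)
  have hmono : StrictMono fun i => (p i).1 := by
    have ml : ∀ i j : Fin (n₁ + 1), i < j → (p (inl i)).1 < (p (inl j)).1 := fun i j hij => by
      have := C₁.strictMono_fst hij
      simp only at this
      rw [pl, pl]
      simp only [leftMap]
      linarith
    have mr : ∀ i j : Fin (n₂ + 1), i < j → (p (inr i)).1 < (p (inr j)).1 := fun i j hij => by
      have := C₂.strictMono_fst hij
      simp only at this
      rw [pr, pr]
      simp only [leftMap]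
      linarith
    have m : (inl (Fin.last n₁) : Fin (n₁ + n₂ + 1)) = inr 0 := Fin.ext (by simp [inl, inr])
    intro i j hij
    simp only
    rcases le_or_gt (j : ℕ) n₁ with hj | hj
    · obtain ⟨b, rfl⟩ := el j hj
      obtain ⟨a, rfl⟩ := el i (by rw [Fin.lt_def] at hij; omega)
      exact ml a b hij
    · obtain ⟨b, rfl⟩ := er j hj.le
      rcases le_or_gt n₁ (i : ℕ) with hi | hi
      · obtain ⟨a, rfl⟩ := er i hi
        exact mr a b ((lr a b).1 hij)
      · obtain ⟨a, rfl⟩ := el i hi.le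
        have q1 := ml a (Fin.last n₁) (by rw [Fin.lt_def]; simpa [inl] using hi)
        rw [m] at q1
        refine q1.trans (mr 0 b ?_)
        simp only [inr] at hj
        rw [Fin.lt_def, Fin.val_zero]
        omega
  have hcons : Consistent p := by
    intro i j j' k hij hjk hij' hjk'
    rcases le_or_gt (k : ℕ) n₁ with hk | hk
    · have a1 : (j : ℕ) ≤ n₁ := by rw [Fin.lt_def] at hjk; omega
      have a2 : (j' : ℕ) ≤ n₁ := by rw [Fin.lt_def] at hjk'; omega
      have a3 : (i : ℕ) ≤ n₁ := by rw [Fin.lt_def] at hij; omega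
      obtain ⟨k, rfl⟩ := el k hk
      obtain ⟨j, rfl⟩ := el j a1
      obtain ⟨j', rfl⟩ := el j' a2
      obtain ⟨i, rfl⟩ := el i a3
      rw [ol, ol]
      have := mul_pos (mul_pos hε hε) (C₁.consistent i j j' k hij hjk hij' hjk')
      linarith
    · rcases le_or_gt n₁ (i : ℕ) with hi | hi
      · have a1 : n₁ ≤ (j : ℕ) := by rw [Fin.lt_def] at hij; omega
        have a2 : n₁ ≤ (j' : ℕ) := by rw [Fin.lt_def] at hij'; omega
        obtain ⟨k, rfl⟩ := er k hk.le
        obtain ⟨j, rfl⟩ := er j a1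
        obtain ⟨j', rfl⟩ := er j' a2
        obtain ⟨i, rfl⟩ := er i hi
        rw [lr] at hij hij' hjk hjk'
        rw [or', or']
        have := mul_pos (mul_pos hε hε) (C₂.consistent i j j' k hij hjk hij' hjk')
        linarith
      · have q := mul_pos (om i j k hi hk hij hjk) (om i j' k hi hk hij' hjk')
        have : (s * orient (p i) (p j) (p k)) * (s * orient (p i) (p j') (p k)) =
          (s * s : ℝ) * (orient (p i) (p j) (p k) * orient (p i) (p j') (p k)) := by ring
        rw [this, hss, one_mul] at q
        exact q
  obtain ⟨C, hC⟩ := Chain.exists_of_consistent p hmono hcons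
  have hvis : ∀ {m : ℕ} (D : Chain m) (f : Fin (m + 1) → Fin (n₁ + n₂ + 1)),
      (∀ i j, i < j ↔ f i < f j) → (∀ i j : Fin (m + 1), (i : ℕ) + 1 = j ↔ (f i : ℕ) + 1 = f j) →
      (∀ i j k, orient (p (f i)) (p (f j)) (p (f k)) =
        ε * orient (D.pt i) (D.pt j) (D.pt k)) →
      ∀ i j, i < j → C.vis (f i) (f j) = D.vis i j := by
    intro m D f hf hf1 ho i k hik
    by_cases h : (i : ℕ) + 1 = k
    · rw [Chain.vis, Chain.vis, if_pos h, if_pos ((hf1 i k).1 h)]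
    · let j : Fin (m + 1) := ⟨i + 1, by rw [Fin.lt_def] at hik; omega⟩
      have hij : i < j := by rw [Fin.lt_def]; simp [j]
      have hjk : j < k := by rw [Fin.lt_def] at hik ⊢; simp [j]; omega
      have v1 := C.vis_eq ((hf _ _).1 hij) ((hf _ _).1 hjk)
      rw [hC, ho] at v1
      have v2 := D.vis_eq hij hjk
      rcases (D.orient_ne_zero hij hjk).lt_or_gt with q | q
      · rw [v1.2 (mul_neg_of_pos_of_neg hε q), v2.2 q]
      · rw [v1.1 (mul_pos hε q), v2.1 q]
  refine ⟨C, hvis C₁ inl (fun i j => (ll i j).symm) (fun i j => Iff.rfl) ol,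
    hvis C₂ inr (fun i j => (lr i j).symm) (fun i j => by simp only [inr]; omega) or', ?_⟩
  intro i k hi hk
  let j : Fin (n₁ + n₂ + 1) := ⟨n₁, by omega⟩
  have hij : i < j := by rw [Fin.lt_def]; exact hi
  have hjk : j < k := by rw [Fin.lt_def]; exact hk
  have v := C.vis_eq hij hjk
  have q := om i j k hi hk hij hjk
  rw [hC] at v
  rcases hs with rfl | rfl
  · exact v.1 (by simpa using q)
  · exact v.2 (by simpa using q)

theorem exists_chain_of_le_one (n : ℕ) (hn : n ≤ 1) : ∃ _ : Chain n, True := by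
  obtain ⟨C, -⟩ := Chain.exists_of_consistent (fun i : Fin (n + 1) => (((i : ℕ) : ℝ), (0 : ℝ)))
    (fun i j h => by simpa using h) (fun i j _ k h1 h2 => by
      rw [Fin.lt_def] at h1 h2
      omega)
  exact ⟨C, trivial⟩

namespace Chain

/-- The convex sum `C₁ ∨ C₂`. It is determined up to equality of visibility triangles. -/
noncomputable def convexSum {n₁ n₂ : ℕ} (C₁ : Chain n₁) (C₂ : Chain n₂) : Chain (n₁ + n₂) :=
  Classical.choose (exists_isSum 1 (Or.inl rfl) C₁ C₂)

theorem convexSum_spec {n₁ n₂ : ℕ} (C₁ : Chain n₁) (C₂ : Chain n₂) :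
    IsSum 1 C₁ C₂ (C₁.convexSum C₂) :=
  Classical.choose_spec (exists_isSum 1 (Or.inl rfl) C₁ C₂)

/-- The concave sum `C₁ ∧ C₂`. It is determined up to equality of visibility triangles. -/
noncomputable def concaveSum {n₁ n₂ : ℕ} (C₁ : Chain n₁) (C₂ : Chain n₂) : Chain (n₁ + n₂) :=
  Classical.choose (exists_isSum (-1) (Or.inr rfl) C₁ C₂)

theorem concaveSum_spec {n₁ n₂ : ℕ} (C₁ : Chain n₁) (C₂ : Chain n₂) :
    IsSum (-1) C₁ C₂ (C₁.concaveSum C₂) :=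
  Classical.choose_spec (exists_isSum (-1) (Or.inr rfl) C₁ C₂)

/-- The primitive chain `E` with only one chain edge; all such chains have the same visibility
triangle. -/
noncomputable def primitive : Chain 1 := Classical.choose (exists_chain_of_le_one 1 le_rfl)

/-- The concave chain with `n` chain edges, `E ∧ … ∧ E` with `n` copies of the primitive chain. For
`n = 0`, by convention, a single point. -/
noncomputable def concave : (n : ℕ) → Chain n
  | 0 => Classical.choose (exists_chain_of_le_one 0 zero_le_one)
  | 1 => primitive
  | n + 2 => concaveSum (n₁ := n + 1) (n₂ := 1) (concave (n + 1)) primitive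

end Chain

/-! ### Partial upper triangulations -/

/-- `i` and `j` are consecutive elements of `S`. -/
def Consecutive {n : ℕ} (S : Finset (Fin (n + 1))) (i j : Fin (n + 1)) : Prop :=
  i ∈ S ∧ j ∈ S ∧ i < j ∧ ∀ k ∈ S, ¬ (i < k ∧ k < j)

/-- The `x`-monotone polygonal curve through the points of the chain with indices in `S`. -/
def Chain.polyline {n : ℕ} (C : Chain n) (S : Finset (Fin (n + 1))) : Set (ℝ × ℝ) :=
  {z | ∃ i j, Consecutive S i j ∧ z ∈ segment ℝ (C.pt i) (C.pt j)}

/-- The geometric graphs that are crossing-free and whose edges are chain edges or upper edges in the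
area between the chain curve and the curve through the points with indices in `S`. -/
def Chain.IsDrawnBelow {n : ℕ} (C : Chain n) (S : Finset (Fin (n + 1)))
    (G : SimpleGraph (Fin (n + 1))) : Prop :=
  CrossingFree C.pt G ∧ ∀ i j, i < j → G.Adj i j →
    (C.IsChainEdge i j ∨ C.IsUpperEdge i j) ∧
      ∀ z ∈ segment ℝ (C.pt i) (C.pt j), ∀ w ∈ C.polyline S, w.1 = z.1 → z.2 ≤ w.2

/-- A partial upper triangulation of a chain `C`. The visible edges form an `x`-monotone curve from the
first to the last point, composed of chain edges and upper edges only; `visible` is the set of indices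
of the vertices of that curve. The edges of the partial upper triangulation are all chain edges, all
visible edges, and a triangulation of the areas between the two, that is, the graph is edge-maximal
among the crossing-free graphs that are drawn there. -/
structure PartialUpperTriangulation {n : ℕ} (C : Chain n) where
  graph : SimpleGraph (Fin (n + 1))
  visible : Finset (Fin (n + 1))
  zero_mem : 0 ∈ visible
  last_mem : Fin.last n ∈ visible
  visible_edge : ∀ i j, Consecutive visible i j → C.IsChainEdge i j ∨ C.IsUpperEdge i j
  chain_adj : ∀ i : Fin n, graph.Adj i.castSucc i.succ
  visible_adj : ∀ i j, Consecutive visible i j → graph.Adj i j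
  maximal : Maximal (C.IsDrawnBelow visible) graph

namespace PartialUpperTriangulation

variable {n : ℕ} {C : Chain n}

/-- The number of visible edges. -/
def numVisible (T : PartialUpperTriangulation C) : ℕ := T.visible.card - 1

theorem card_visible (T : PartialUpperTriangulation C) : T.visible.card = T.numVisible + 1 := by
  have : 0 < T.visible.card := Finset.card_pos.2 ⟨0, T.zero_mem⟩
  unfold numVisible
  omega

/-- The vertices `i_0 < i_1 < … < i_v` of the curve of visible edges. -/
def visibleVertex (T : PartialUpperTriangulation C) (l : Fin (T.numVisible + 1)) : Fin (n + 1) :=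
  T.visible.orderEmbOfFin T.card_visible l

/-- The triangles of a partial upper triangulation, given by their sets of vertices. As all edges are
chain edges or upper edges, no point of the chain lies inside a triangle bounded by three edges, so
every such triangle is a face. -/
def triangles (T : PartialUpperTriangulation C) : Set (Finset (Fin (n + 1))) :=
  T.graph.cliqueSet 3

end PartialUpperTriangulation

/-- The vertices of the curve of visible edges of `T₁` followed by those of `T₂`, as indices of points
of a sum of the two chains: the `l`-th point of a sum of chains with `v₁` and `v₂` chain edges stands
for the `l`-th vertex on the concatenated curve of visible edges. -/
def glue {n₁ n₂ : ℕ} {C₁ : Chain n₁} {C₂ : Chain n₂} (T₁ : PartialUpperTriangulation C₁)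
    (T₂ : PartialUpperTriangulation C₂) (l : Fin (T₁.numVisible + T₂.numVisible + 1)) :
    Fin (n₁ + n₂ + 1) :=
  if h : (l : ℕ) ≤ T₁.numVisible then inl (T₁.visibleVertex ⟨l, by omega⟩)
  else inr (T₂.visibleVertex ⟨l - T₁.numVisible, by omega⟩)

end ChainTri

open ChainTri

namespace ChainTri

/-! A chain edge or upper edge (an admissible pair) has all chain points between its endpoints
strictly below it. Hence two such edges cross exactly when their endpoints interleave
(`Chain.crossingFree_iff`), and such an edge stays below the visible curve exactly when it passes
over no visible vertex (`Chain.below_polyline_iff`). The visible vertices are then the vertices not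
covered by any edge, so the graph alone determines the partial upper triangulation (`ext_graph`),
and the geometric notion becomes the order-theoretic `IsUpperTri`: an admissible pair whose
insertion crosses nothing and covers no new vertex is already an edge.

In this language, take a partial upper triangulation of `C₁ ∨ C₂` and let `m` be the common point.
Its restrictions to both sides are `T₁` and `T₂`. The remaining edges are bridges over `m`, all of
which are admissible. An endpoint of a bridge is visible in `T₁` or `T₂`, since an edge covering it
would cross the bridge. So the bridges, together with the visible edges of `T₁` and `T₂`, form a
graph on the concatenated visible curve whose admissible pairs are the neighbors and the bridges.
These are exactly the admissible pairs of `Cave ∨ Cave`, and the graph is `T₃`.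

Conversely, the union of `T₁`, `T₂`, `T₃` restricts to the three given graphs, because `T₃` shares
only visible edges with `T₁` and `T₂`. The delicate point is maximality of the union: a bridge may
cover a vertex `s` that is visible in `T₁`, and so seem to permit a new edge of `C₁` over `s`. But a
covered `s ≠ m` is itself an endpoint of a bridge (`exists_bridge_right`, `exists_bridge_left`), and
that bridge would cross the new edge. The two directions are `isUpperTri_sup` and
`isUpperTri_comap`.

A triangle with vertices on both sides of `m` has only visible vertices, so it belongs to `T₃`;
every triangle of `T₃` straddles `m`. Thus the triangles split into three disjoint families. -/

/-! ### Non-crossing graphs on a linear order -/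

section NonCrossing

variable {V : Type*} [LinearOrder V]

/-- The vertex `k` lies strictly below some edge of `G`. -/
def Covered (G : SimpleGraph V) (k : V) : Prop := ∃ i j, i < k ∧ k < j ∧ G.Adj i j

/-- No two edges of `G` have interleaved endpoints. -/
def NonCrossing (G : SimpleGraph V) : Prop :=
  ∀ a b c d, a < c → c < b → b < d → G.Adj a b → ¬ G.Adj c d

/-- Edge-maximal among the non-crossing graphs with edges in `U` that have the same vertices on their
upper hull. -/
structure IsUpperTri (U : V → V → Prop) (G : SimpleGraph V) : Prop where
  adm : ∀ i j, i < j → G.Adj i j → U i j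
  nonCrossing : NonCrossing G
  max : ∀ i j, i < j → U i j → (∀ k, i < k → k < j → Covered G k) →
    (∀ x y, i < x → x < j → j < y → ¬ G.Adj x y) →
    (∀ x y, x < i → i < y → y < j → ¬ G.Adj x y) → G.Adj i j

theorem IsUpperTri.adj_of_covBy {U : V → V → Prop} {G : SimpleGraph V} (h : IsUpperTri U G)
    (hU : ∀ i j, i ⋖ j → U i j) {i j : V} (hij : i ⋖ j) : G.Adj i j :=
  h.max i j hij.lt (hU i j hij) (fun _ h1 h2 => (hij.2 h1 h2).elim)
    (fun _ _ h1 h2 => (hij.2 h1 h2).elim) (fun _ _ _ h1 h2 => (hij.2 h1 h2).elim)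

/-- Consecutive vertices on the upper hull are adjacent. -/
theorem NonCrossing.adj_of_not_covered [Finite V] {G : SimpleGraph V} (h : NonCrossing G)
    (hc : ∀ i j, i ⋖ j → G.Adj i j) {i j : V} (hij : i < j) (hi : ¬ Covered G i)
    (hj : ¬ Covered G j) (hk : ∀ k, i < k → k < j → Covered G k) : G.Adj i j := by
  obtain ⟨u, hu, huj⟩ := exists_covBy_le_of_lt hij
  -- Take the farthest neighbor `b` of `i` up to `j`. If `b < j`, an edge over `b` ends by `j`; it
  -- would cover `i`, be a longer edge from `i`, or cross `ib`.
  obtain ⟨b, ⟨hib, hbj, hab⟩, hmax⟩ := Set.exists_max_image {b | i < b ∧ b ≤ j ∧ G.Adj i b} id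
    (Set.toFinite _) ⟨u, hu.lt, huj, hc _ _ hu⟩
  rcases hbj.eq_or_lt with rfl | hbj
  · exact hab
  obtain ⟨x, y, hxb, hby, hxy⟩ := hk b hib hbj
  have hyj : y ≤ j := not_lt.1 fun hy => hj ⟨x, y, hxb.trans hbj, hy, hxy⟩
  rcases lt_trichotomy x i with hx | rfl | hx
  · exact (hi ⟨x, y, hx, hib.trans hby, hxy⟩).elim
  · exact (hby.not_ge (hmax y ⟨hib.trans hby, hyj, hxy⟩)).elim
  · exact (h i b x y hx hxb hby hab hxy).elim

/-- The admissible pairs of a convex sum of two concave chains: neighbors, and pairs with the common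
point `m` of the two chains in between. -/
def BridgeOrCovBy (m : V) (x y : V) : Prop := x ⋖ y ∨ (x < m ∧ m < y)

/-- Only bridges can cover `s`. Among those, let `ab` have the leftmost right end. Whatever would
cross `sb` either crosses `ab` or covers `s` and ends before `b`, so maximality supplies the edge
`sb`. -/
theorem IsUpperTri.exists_bridge_right [Finite V] {m : V} {G : SimpleGraph V}
    (h : IsUpperTri (BridgeOrCovBy m) G) {s : V} (hs : s < m) (hc : Covered G s) :
    ∃ b, m < b ∧ G.Adj s b := by
  have key : ∀ x y, x < s → s < y → G.Adj x y → m < y := fun x y hx hy hxy => by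
    rcases h.adm x y (hx.trans hy) hxy with h1 | h1
    · exact (h1.2 hx hy).elim
    · exact h1.2
  obtain ⟨a₀, b₀, ha₀, hb₀, hab₀⟩ := hc
  obtain ⟨b, ⟨hb, a, ha, hab⟩, hmin⟩ := Set.exists_min_image {b | s < b ∧ ∃ a, a < s ∧ G.Adj a b} id
    (Set.toFinite _) ⟨b₀, hb₀, a₀, ha₀, hab₀⟩
  have hmb := key a b ha hb hab
  refine ⟨b, hmb, h.max s b hb (Or.inr ⟨hs, hmb⟩)
    (fun k h1 h2 => ⟨a, b, ha.trans h1, h2, hab⟩)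
    (fun x y h1 h2 h3 => h.nonCrossing a b x y (ha.trans h1) h2 h3 hab)
    (fun x y h1 h2 h3 h4 => h3.not_ge (hmin y ⟨h2, x, h1, h4⟩))⟩

theorem IsUpperTri.exists_bridge_left [Finite V] {m : V} {G : SimpleGraph V}
    (h : IsUpperTri (BridgeOrCovBy m) G) {s : V} (hs : m < s) (hc : Covered G s) :
    ∃ a, a < m ∧ G.Adj a s := by
  have key : ∀ x y, x < s → s < y → G.Adj x y → x < m := fun x y hx hy hxy => by
    rcases h.adm x y (hx.trans hy) hxy with h1 | h1
    · exact (h1.2 hx hy).elim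
    · exact h1.1
  obtain ⟨a₀, b₀, ha₀, hb₀, hab₀⟩ := hc
  obtain ⟨a, ⟨ha, b, hb, hab⟩, hmax⟩ := Set.exists_max_image {a | a < s ∧ ∃ b, s < b ∧ G.Adj a b} id
    (Set.toFinite _) ⟨a₀, ha₀, b₀, hb₀, hab₀⟩
  have ham := key a b ha hb hab
  refine ⟨a, ham, h.max a s ha (Or.inr ⟨ham, hs⟩)
    (fun k h1 h2 => ⟨a, b, h1, h2.trans hb, hab⟩)
    (fun x y h1 h2 h3 h4 => h1.not_ge (hmax x ⟨h2, y, h3, h4⟩))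
    (fun x y h1 h2 h3 h4 => h.nonCrossing x y a b h1 h2 (h3.trans hb) h4 hab)⟩

end NonCrossing

/-! ### Gluing non-crossing graphs at a common vertex -/

section Glueing

variable {A B E W : Type*} [LinearOrder A] [LinearOrder B] [LinearOrder E] [LinearOrder W]

/-- `A` and `B` are the vertices up to and from `l top = r bot`, and `E` is the union of the upper hull
of `G₁` and that of `G₂`, where `m` stands for the common vertex. -/
structure IsGlueing (l : A → W) (r : B → W) (g : E → W) (m : E) (G₁ : SimpleGraph A)
    (G₂ : SimpleGraph B) : Prop where
  hl : StrictMono l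
  hr : StrictMono r
  hg : StrictMono g
  l_iff : ∀ w, w ≤ g m ↔ ∃ a, l a = w
  r_iff : ∀ w, g m ≤ w ↔ ∃ b, r b = w
  gl_iff : ∀ a, (∃ x, g x = l a) ↔ ¬ Covered G₁ a
  gr_iff : ∀ b, (∃ x, g x = r b) ↔ ¬ Covered G₂ b

theorem map_adj_of_strictMono {f : A → W} (hf : StrictMono f) {G : SimpleGraph A} {u v : W} :
    (G.map f).Adj u v ↔ ∃ a b, G.Adj a b ∧ f a = u ∧ f b = v := by
  rw [SimpleGraph.map_adj']
  refine ⟨fun h => h.2, fun h => ⟨?_, h⟩⟩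
  obtain ⟨a, b, hab, rfl, rfl⟩ := h
  exact hf.injective.ne hab.ne

namespace IsGlueing

variable {l : A → W} {r : B → W} {g : E → W} {m : E} {G₁ : SimpleGraph A} {G₂ : SimpleGraph B}
  {U₁ : A → A → Prop} {U₂ : B → B → Prop} {U : W → W → Prop}

theorem l_le (h : IsGlueing l r g m G₁ G₂) (a : A) : l a ≤ g m := (h.l_iff _).2 ⟨a, rfl⟩

theorem le_r (h : IsGlueing l r g m G₁ G₂) (b : B) : g m ≤ r b := (h.r_iff _).2 ⟨b, rfl⟩

/-- Neighbors in `E` on the left side are consecutive hull vertices of `G₁`. With `covBy_of_adj_l`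
this says that `G₁` and the glued curve share exactly the visible edges. -/
theorem adj_l_of_covBy [Finite A] (h : IsGlueing l r g m G₁ G₂) (h₁ : IsUpperTri U₁ G₁)
    (hU₁ : ∀ i j, i ⋖ j → U₁ i j) {x y : E} (hxy : x ⋖ y) {a b : A} (ha : l a = g x)
    (hb : l b = g y) : G₁.Adj a b := by
  refine h₁.nonCrossing.adj_of_not_covered (fun i j => h₁.adj_of_covBy hU₁)
    (h.hl.lt_iff_lt.1 (ha ▸ hb ▸ h.hg hxy.lt)) ((h.gl_iff a).1 ⟨x, ha.symm⟩)
    ((h.gl_iff b).1 ⟨y, hb.symm⟩) fun k h1 h2 => ?_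
  by_contra hk
  obtain ⟨z, hz⟩ := (h.gl_iff k).2 hk
  exact hxy.2 (h.hg.lt_iff_lt.1 (by rw [hz, ← ha]; exact h.hl h1))
    (h.hg.lt_iff_lt.1 (by rw [hz, ← hb]; exact h.hl h2))

theorem adj_r_of_covBy [Finite B] (h : IsGlueing l r g m G₁ G₂) (h₂ : IsUpperTri U₂ G₂)
    (hU₂ : ∀ i j, i ⋖ j → U₂ i j) {x y : E} (hxy : x ⋖ y) {a b : B} (ha : r a = g x)
    (hb : r b = g y) : G₂.Adj a b := by
  refine h₂.nonCrossing.adj_of_not_covered (fun i j => h₂.adj_of_covBy hU₂)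
    (h.hr.lt_iff_lt.1 (ha ▸ hb ▸ h.hg hxy.lt)) ((h.gr_iff a).1 ⟨x, ha.symm⟩)
    ((h.gr_iff b).1 ⟨y, hb.symm⟩) fun k h1 h2 => ?_
  by_contra hk
  obtain ⟨z, hz⟩ := (h.gr_iff k).2 hk
  exact hxy.2 (h.hg.lt_iff_lt.1 (by rw [hz, ← ha]; exact h.hr h1))
    (h.hg.lt_iff_lt.1 (by rw [hz, ← hb]; exact h.hr h2))

/-- A hull vertex strictly between `x` and `y` would be covered by the edge `ab`. -/
theorem covBy_of_adj_l (h : IsGlueing l r g m G₁ G₂) {x y : E} (hxy : x < y) {a b : A}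
    (ha : l a = g x) (hb : l b = g y) (hab : G₁.Adj a b) : x ⋖ y := by
  refine ⟨hxy, fun z h1 h2 => ?_⟩
  have h3 := h.hg h1
  have h4 := h.hg h2
  obtain ⟨k, hk⟩ := (h.l_iff (g z)).1 (h4.le.trans (hb ▸ h.l_le b))
  rw [← ha, ← hk, h.hl.lt_iff_lt] at h3
  rw [← hb, ← hk, h.hl.lt_iff_lt] at h4
  exact (h.gl_iff k).1 ⟨z, hk.symm⟩ ⟨a, b, h3, h4, hab⟩

theorem covBy_of_adj_r (h : IsGlueing l r g m G₁ G₂) {x y : E} (hxy : x < y) {a b : B}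
    (ha : r a = g x) (hb : r b = g y) (hab : G₂.Adj a b) : x ⋖ y := by
  refine ⟨hxy, fun z h1 h2 => ?_⟩
  have h3 := h.hg h1
  have h4 := h.hg h2
  obtain ⟨k, hk⟩ := (h.r_iff (g z)).1 ((ha ▸ h.le_r a).trans h3.le)
  rw [← ha, ← hk, h.hr.lt_iff_lt] at h3
  rw [← hb, ← hk, h.hr.lt_iff_lt] at h4
  exact (h.gr_iff k).1 ⟨z, hk.symm⟩ ⟨a, b, h3, h4, hab⟩

/-- A union of graphs on `A`, `B` and `E`. -/
theorem sup_adj (h : IsGlueing l r g m G₁ G₂) {G₃ : SimpleGraph E} {u v : W} :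
    (G₁.map l ⊔ G₂.map r ⊔ G₃.map g).Adj u v ↔ (∃ a b, G₁.Adj a b ∧ l a = u ∧ l b = v) ∨
      (∃ a b, G₂.Adj a b ∧ r a = u ∧ r b = v) ∨ ∃ a b, G₃.Adj a b ∧ g a = u ∧ g b = v := by
  rw [SimpleGraph.sup_adj, SimpleGraph.sup_adj, map_adj_of_strictMono h.hl,
    map_adj_of_strictMono h.hr, map_adj_of_strictMono h.hg, or_assoc]

/-! ### Assembling three upper triangulations -/

section Union

variable {G₃ : SimpleGraph E}

theorem comap_l_sup [Finite A] (h : IsGlueing l r g m G₁ G₂) (h₁ : IsUpperTri U₁ G₁)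
    (hU₁ : ∀ i j, i ⋖ j → U₁ i j) (h₃ : IsUpperTri (BridgeOrCovBy m) G₃) :
    (G₁.map l ⊔ G₂.map r ⊔ G₃.map g).comap l = G₁ := by
  -- An edge of `G₃` with both ends on the left is no bridge, hence a visible edge already present
  -- in `G₁`.
  have key : ∀ x y a b, x < y → G₃.Adj x y → g x = l a → g y = l b → G₁.Adj a b := by
    intro x y a b hxy hadj ha hb
    rcases h₃.adm x y hxy hadj with h1 | h1
    · exact h.adj_l_of_covBy h₁ hU₁ h1 ha.symm hb.symm
    · exact (((hb ▸ h.l_le b : g y ≤ g m)).not_gt (h.hg h1.2)).elim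
  ext a b
  rw [SimpleGraph.comap_adj, h.sup_adj]
  constructor
  · rintro (⟨a', b', hab, ha, hb⟩ | ⟨a', b', hab, ha, hb⟩ | ⟨x, y, hxy, hx, hy⟩)
    · rwa [← h.hl.injective ha, ← h.hl.injective hb]
    · have e1 := le_antisymm (ha ▸ h.l_le a) (h.le_r a')
      have e2 := le_antisymm (hb ▸ h.l_le b) (h.le_r b')
      exact (hab.ne (h.hr.injective (e1.trans e2.symm))).elim
    · rcases hxy.ne.lt_or_gt with h1 | h1
      · exact key x y a b h1 hxy hx hy
      · exact (key y x b a h1 hxy.symm hy hx).symm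
  · exact fun hab => Or.inl ⟨a, b, hab, rfl, rfl⟩

theorem comap_r_sup [Finite B] (h : IsGlueing l r g m G₁ G₂) (h₂ : IsUpperTri U₂ G₂)
    (hU₂ : ∀ i j, i ⋖ j → U₂ i j) (h₃ : IsUpperTri (BridgeOrCovBy m) G₃) :
    (G₁.map l ⊔ G₂.map r ⊔ G₃.map g).comap r = G₂ := by
  have key : ∀ x y a b, x < y → G₃.Adj x y → g x = r a → g y = r b → G₂.Adj a b := by
    intro x y a b hxy hadj ha hb
    rcases h₃.adm x y hxy hadj with h1 | h1
    · exact h.adj_r_of_covBy h₂ hU₂ h1 ha.symm hb.symm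
    · exact (((ha ▸ h.le_r a : g m ≤ g x)).not_gt (h.hg h1.1)).elim
  ext a b
  rw [SimpleGraph.comap_adj, h.sup_adj]
  constructor
  · rintro (⟨a', b', hab, ha, hb⟩ | ⟨a', b', hab, ha, hb⟩ | ⟨x, y, hxy, hx, hy⟩)
    · have e1 := le_antisymm (h.l_le a') (ha ▸ h.le_r a)
      have e2 := le_antisymm (h.l_le b') (hb ▸ h.le_r b)
      exact (hab.ne (h.hl.injective (e1.trans e2.symm))).elim
    · rwa [← h.hr.injective ha, ← h.hr.injective hb]
    · rcases hxy.ne.lt_or_gt with h1 | h1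
      · exact key x y a b h1 hxy hx hy
      · exact (key y x b a h1 hxy.symm hy hx).symm
  · exact fun hab => Or.inr (Or.inl ⟨a, b, hab, rfl, rfl⟩)

theorem comap_g_sup (h : IsGlueing l r g m G₁ G₂) (h₃ : ∀ x y, x ⋖ y → G₃.Adj x y) :
    (G₁.map l ⊔ G₂.map r ⊔ G₃.map g).comap g = G₃ := by
  ext x y
  rw [SimpleGraph.comap_adj, h.sup_adj]
  constructor
  · rintro (⟨a, b, hab, ha, hb⟩ | ⟨a, b, hab, ha, hb⟩ | ⟨x', y', hxy, hx, hy⟩)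
    · have hne : x ≠ y := fun e => hab.ne (h.hl.injective (by rw [ha, hb, e]))
      rcases hne.lt_or_gt with h1 | h1
      · exact h₃ _ _ (h.covBy_of_adj_l h1 ha hb hab)
      · exact (h₃ _ _ (h.covBy_of_adj_l h1 hb ha hab.symm)).symm
    · have hne : x ≠ y := fun e => hab.ne (h.hr.injective (by rw [ha, hb, e]))
      rcases hne.lt_or_gt with h1 | h1
      · exact h₃ _ _ (h.covBy_of_adj_r h1 ha hb hab)
      · exact (h₃ _ _ (h.covBy_of_adj_r h1 hb ha hab.symm)).symm
    · rwa [← h.hg.injective hx, ← h.hg.injective hy]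
  · exact fun hab => Or.inr (Or.inr ⟨x, y, hab, rfl, rfl⟩)

/-- Edges of `G₃` between neighbors are absorbed into `G₁` or `G₂`, which leaves only bridges as the
third case. -/
theorem sup_adj_of_lt [Finite A] [Finite B] (h : IsGlueing l r g m G₁ G₂) (h₁ : IsUpperTri U₁ G₁)
    (hU₁ : ∀ i j, i ⋖ j → U₁ i j) (h₂ : IsUpperTri U₂ G₂) (hU₂ : ∀ i j, i ⋖ j → U₂ i j)
    (h₃ : IsUpperTri (BridgeOrCovBy m) G₃) {u v : W} (huv : u < v)
    (hadj : (G₁.map l ⊔ G₂.map r ⊔ G₃.map g).Adj u v) :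
    (∃ a b, a < b ∧ G₁.Adj a b ∧ l a = u ∧ l b = v) ∨
      (∃ a b, a < b ∧ G₂.Adj a b ∧ r a = u ∧ r b = v) ∨
      ∃ x y, x < m ∧ m < y ∧ G₃.Adj x y ∧ g x = u ∧ g y = v := by
  rcases h.sup_adj.1 hadj with ⟨a, b, hab, rfl, rfl⟩ | ⟨a, b, hab, rfl, rfl⟩ | ⟨x, y, hxy, rfl, rfl⟩
  · exact Or.inl ⟨a, b, h.hl.lt_iff_lt.1 huv, hab, rfl, rfl⟩
  · exact Or.inr (Or.inl ⟨a, b, h.hr.lt_iff_lt.1 huv, hab, rfl, rfl⟩)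
  · have hlt := h.hg.lt_iff_lt.1 huv
    rcases h₃.adm x y hlt hxy with h4 | h4
    · rcases le_or_gt y m with hy | hy
      · obtain ⟨b, hb⟩ := (h.l_iff (g y)).1 (h.hg.monotone hy)
        obtain ⟨a, ha⟩ := (h.l_iff (g x)).1 (h.hg.monotone (hlt.le.trans hy))
        exact Or.inl ⟨a, b, h.hl.lt_iff_lt.1 (by rwa [ha, hb]), h.adj_l_of_covBy h₁ hU₁ h4 ha hb,
          ha, hb⟩
      · have hx : m ≤ x := not_lt.1 fun hx => h4.2 hx hy
        obtain ⟨b, hb⟩ := (h.r_iff (g y)).1 (h.hg.monotone hy.le)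
        obtain ⟨a, ha⟩ := (h.r_iff (g x)).1 (h.hg.monotone hx)
        exact Or.inr (Or.inl ⟨a, b, h.hr.lt_iff_lt.1 (by rwa [ha, hb]),
          h.adj_r_of_covBy h₂ hU₂ h4 ha hb, ha, hb⟩)
    · exact Or.inr (Or.inr ⟨x, y, h4.1, h4.2, hxy, rfl, rfl⟩)

/-- Points of `E` are hull vertices of `G₁` or `G₂`, so no edge of these two graphs covers them. -/
theorem covered_of_covered_sup [Finite A] [Finite B] (h : IsGlueing l r g m G₁ G₂)
    (h₁ : IsUpperTri U₁ G₁) (hU₁ : ∀ i j, i ⋖ j → U₁ i j) (h₂ : IsUpperTri U₂ G₂)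
    (hU₂ : ∀ i j, i ⋖ j → U₂ i j) (h₃ : IsUpperTri (BridgeOrCovBy m) G₃) {s : E}
    (hs : Covered (G₁.map l ⊔ G₂.map r ⊔ G₃.map g) (g s)) : Covered G₃ s := by
  obtain ⟨u, v, hu, hv, huv⟩ := hs
  rcases h.sup_adj_of_lt h₁ hU₁ h₂ hU₂ h₃ (hu.trans hv) huv with
    ⟨a, b, -, hab, rfl, rfl⟩ | ⟨a, b, -, hab, rfl, rfl⟩ | ⟨x, y, -, -, hxy, rfl, rfl⟩
  · obtain ⟨k, hk⟩ := (h.l_iff (g s)).1 (hv.le.trans (h.l_le b))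
    rw [← hk, h.hl.lt_iff_lt] at hu hv
    exact ((h.gl_iff k).1 ⟨s, hk.symm⟩ ⟨a, b, hu, hv, hab⟩).elim
  · obtain ⟨k, hk⟩ := (h.r_iff (g s)).1 ((h.le_r a).trans hu.le)
    rw [← hk, h.hr.lt_iff_lt] at hu hv
    exact ((h.gr_iff k).1 ⟨s, hk.symm⟩ ⟨a, b, hu, hv, hab⟩).elim
  · exact ⟨x, y, h.hg.lt_iff_lt.1 hu, h.hg.lt_iff_lt.1 hv, hxy⟩

theorem isUpperTri_sup [Finite A] [Finite B] [Finite E] (h : IsGlueing l r g m G₁ G₂)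
    (h₁ : IsUpperTri U₁ G₁) (hU₁ : ∀ i j, i ⋖ j → U₁ i j) (h₂ : IsUpperTri U₂ G₂)
    (hU₂ : ∀ i j, i ⋖ j → U₂ i j) (h₃ : IsUpperTri (BridgeOrCovBy m) G₃)
    (hUl : ∀ i j, i < j → (U (l i) (l j) ↔ U₁ i j)) (hUr : ∀ i j, i < j → (U (r i) (r j) ↔ U₂ i j))
    (hU : ∀ u v, u < g m → g m < v → U u v) :
    IsUpperTri U (G₁.map l ⊔ G₂.map r ⊔ G₃.map g) := by
  have cases := fun {u v : W} => h.sup_adj_of_lt h₁ hU₁ h₂ hU₂ h₃ (u := u) (v := v)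
  have adj_l : ∀ {a b}, G₁.Adj a b → (G₁.map l ⊔ G₂.map r ⊔ G₃.map g).Adj (l a) (l b) :=
    fun hab => h.sup_adj.2 (Or.inl ⟨_, _, hab, rfl, rfl⟩)
  have adj_r : ∀ {a b}, G₂.Adj a b → (G₁.map l ⊔ G₂.map r ⊔ G₃.map g).Adj (r a) (r b) :=
    fun hab => h.sup_adj.2 (Or.inr (Or.inl ⟨_, _, hab, rfl, rfl⟩))
  have adj_g : ∀ {a b}, G₃.Adj a b → (G₁.map l ⊔ G₂.map r ⊔ G₃.map g).Adj (g a) (g b) :=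
    fun hab => h.sup_adj.2 (Or.inr (Or.inr ⟨_, _, hab, rfl, rfl⟩))
  refine ⟨?_, ?_, ?_⟩
  · intro u v huv hadj
    rcases cases huv hadj with ⟨a, b, hlt, hab, rfl, rfl⟩ | ⟨a, b, hlt, hab, rfl, rfl⟩ |
      ⟨x, y, hx, hy, -, rfl, rfl⟩
    · exact (hUl a b hlt).2 (h₁.adm a b hlt hab)
    · exact (hUr a b hlt).2 (h₂.adm a b hlt hab)
    · exact hU _ _ (h.hg hx) (h.hg hy)
  · intro a b c d hac hcb hbd hab hcd
    rcases cases (hac.trans hcb) hab with ⟨a, b, -, e₁, rfl, rfl⟩ | ⟨a, b, -, e₁, rfl, rfl⟩ |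
        ⟨a, b, ha, hb, e₁, rfl, rfl⟩ <;>
      rcases cases (hcb.trans hbd) hcd with ⟨c, d, -, e₂, rfl, rfl⟩ | ⟨c, d, -, e₂, rfl, rfl⟩ |
        ⟨c, d, hc, hd, e₂, rfl, rfl⟩
    · rw [h.hl.lt_iff_lt] at hac hcb hbd
      exact h₁.nonCrossing a b c d hac hcb hbd e₁ e₂
    · exact hcb.not_ge ((h.l_le b).trans (h.le_r c))
    -- An edge of `G₁` crossing a bridge would cover the bridge's left endpoint, which is a hull
    -- vertex.
    · obtain ⟨k, hk⟩ := (h.l_iff (g c)).1 (h.hg hc).le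
      rw [← hk, h.hl.lt_iff_lt] at hac hcb
      exact (h.gl_iff k).1 ⟨c, hk.symm⟩ ⟨a, b, hac, hcb, e₁⟩
    · exact (hac.trans (hcb.trans hbd)).not_ge ((h.l_le d).trans (h.le_r a))
    · rw [h.hr.lt_iff_lt] at hac hcb hbd
      exact h₂.nonCrossing a b c d hac hcb hbd e₁ e₂
    · exact ((h.le_r a).trans_lt hac).not_gt (h.hg hc)
    · exact (hbd.trans_le (h.l_le d)).not_gt (h.hg hb)
    · obtain ⟨k, hk⟩ := (h.r_iff (g b)).1 (h.hg hb).le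
      rw [← hk, h.hr.lt_iff_lt] at hcb hbd
      exact (h.gr_iff k).1 ⟨b, hk.symm⟩ ⟨c, d, hcb, hbd, e₂⟩
    · rw [h.hg.lt_iff_lt] at hac hcb hbd
      exact h₃.nonCrossing a b c d hac hcb hbd e₁ e₂
  · intro i j hij hUij hcov hx hx'
    rcases le_or_gt j (g m) with hj | hj
    · obtain ⟨a, rfl⟩ := (h.l_iff i).1 (hij.le.trans hj)
      obtain ⟨b, rfl⟩ := (h.l_iff j).1 hj
      have hab := h.hl.lt_iff_lt.1 hij
      refine adj_l (h₁.max a b hab ((hUl a b hab).1 hUij) (fun k h4 h5 => ?_)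
        (fun x y h4 h5 h6 h7 => hx _ _ (h.hl h4) (h.hl h5) (h.hl h6) (adj_l h7))
        (fun x y h4 h5 h6 h7 => hx' _ _ (h.hl h4) (h.hl h5) (h.hl h6) (adj_l h7)))
      -- If `k` were covered only by bridges, it would itself carry a bridge, which crosses the
      -- candidate edge.
      by_contra hk
      obtain ⟨s, hs⟩ := (h.gl_iff k).2 hk
      have c := hcov (l k) (h.hl h4) (h.hl h5)
      rw [← hs] at c
      have hsm : s < m := h.hg.lt_iff_lt.1 (hs ▸ (h.hl h5).trans_le hj)
      obtain ⟨q, hq, hsq⟩ := h₃.exists_bridge_right hsm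
        (h.covered_of_covered_sup h₁ hU₁ h₂ hU₂ h₃ c)
      exact hx (g s) (g q) (hs ▸ h.hl h4) (hs ▸ h.hl h5) (hj.trans_lt (h.hg hq)) (adj_g hsq)
    rcases le_or_gt (g m) i with hi | hi
    · obtain ⟨a, rfl⟩ := (h.r_iff i).1 hi
      obtain ⟨b, rfl⟩ := (h.r_iff j).1 hj.le
      have hab := h.hr.lt_iff_lt.1 hij
      refine adj_r (h₂.max a b hab ((hUr a b hab).1 hUij) (fun k h4 h5 => ?_)
        (fun x y h4 h5 h6 h7 => hx _ _ (h.hr h4) (h.hr h5) (h.hr h6) (adj_r h7))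
        (fun x y h4 h5 h6 h7 => hx' _ _ (h.hr h4) (h.hr h5) (h.hr h6) (adj_r h7)))
      by_contra hk
      obtain ⟨s, hs⟩ := (h.gr_iff k).2 hk
      have c := hcov (r k) (h.hr h4) (h.hr h5)
      rw [← hs] at c
      have hsm : m < s := h.hg.lt_iff_lt.1 (hs ▸ hi.trans_lt (h.hr h4))
      obtain ⟨q, hq, hsq⟩ := h₃.exists_bridge_left hsm
        (h.covered_of_covered_sup h₁ hU₁ h₂ hU₂ h₃ c)
      exact hx' (g q) (g s) ((h.hg hq).trans_le hi) (hs ▸ h.hr h4) (hs ▸ h.hr h5) (adj_g hsq)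
    obtain ⟨a, rfl⟩ := (h.l_iff i).1 hi.le
    obtain ⟨b, rfl⟩ := (h.r_iff j).1 hj.le
    -- The candidate is a bridge. An edge covering one of its ends would cross it, so both ends lie
    -- on the hulls and maximality of `G₃` applies.
    obtain ⟨x, ex⟩ := (h.gl_iff a).2 fun ⟨p, q, hp, hq, hpq⟩ =>
      hx' _ _ (h.hl hp) (h.hl hq) ((h.l_le q).trans_lt hj) (adj_l hpq)
    obtain ⟨y, ey⟩ := (h.gr_iff b).2 fun ⟨p, q, hp, hq, hpq⟩ =>
      hx _ _ (hi.trans_le (h.le_r p)) (h.hr hp) (h.hr hq) (adj_r hpq)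
    rw [← ex] at hi hij hcov hx hx' ⊢
    rw [← ey] at hj hij hcov hx hx' ⊢
    rw [h.hg.lt_iff_lt] at hi hj hij
    exact adj_g (h₃.max x y hij (Or.inr ⟨hi, hj⟩)
      (fun k h4 h5 => h.covered_of_covered_sup h₁ hU₁ h₂ hU₂ h₃ (hcov _ (h.hg h4) (h.hg h5)))
      (fun u v h4 h5 h6 h7 => hx _ _ (h.hg h4) (h.hg h5) (h.hg h6) (adj_g h7))
      (fun u v h4 h5 h6 h7 => hx' _ _ (h.hg h4) (h.hg h5) (h.hg h6) (adj_g h7)))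

end Union

end IsGlueing

/-- Restriction to an interval. -/
theorem IsUpperTri.comap {U : W → W → Prop} {U₁ : A → A → Prop} {G : SimpleGraph W}
    (h : IsUpperTri U G) {f : A → W} (hf : StrictMono f)
    (hconv : ∀ a b w, f a ≤ w → w ≤ f b → ∃ c, f c = w)
    (hU : ∀ i j, i < j → (U (f i) (f j) ↔ U₁ i j)) : IsUpperTri U₁ (G.comap f) := by
  refine ⟨fun i j hij hadj => (hU i j hij).1 (h.adm _ _ (hf hij) hadj),
    fun a b c d h1 h2 h3 => h.nonCrossing _ _ _ _ (hf h1) (hf h2) (hf h3), ?_⟩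
  intro i j hij hUij hcov hx hx'
  refine h.max _ _ (hf hij) ((hU i j hij).2 hUij) ?_ ?_ ?_
  · intro k h1 h2
    obtain ⟨c, rfl⟩ := hconv i j k h1.le h2.le
    obtain ⟨p, q, hp, hq, hpq⟩ := hcov c (hf.lt_iff_lt.1 h1) (hf.lt_iff_lt.1 h2)
    exact ⟨_, _, hf hp, hf hq, hpq⟩
  · intro x y h1 h2 h3 hxy
    obtain ⟨c, rfl⟩ := hconv i j x h1.le h2.le
    -- The vertex `x` is covered by an edge `pq` inside the interval. Either `y` is at most the
    -- image of `q`, hence also inside the interval, or `xy` crosses `pq`.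
    obtain ⟨p, q, hp, hq, hpq⟩ := hcov c (hf.lt_iff_lt.1 h1) (hf.lt_iff_lt.1 h2)
    rcases le_or_gt y (f q) with hy | hy
    · obtain ⟨d, rfl⟩ := hconv j q y h3.le hy
      exact hx c d (hf.lt_iff_lt.1 h1) (hf.lt_iff_lt.1 h2) (hf.lt_iff_lt.1 h3) hxy
    · exact h.nonCrossing _ _ _ _ (hf hp) (hf hq) hy hpq hxy
  · intro x y h1 h2 h3 hxy
    obtain ⟨c, rfl⟩ := hconv i j y h2.le h3.le
    obtain ⟨p, q, hp, hq, hpq⟩ := hcov c (hf.lt_iff_lt.1 h2) (hf.lt_iff_lt.1 h3)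
    rcases le_or_gt (f p) x with hy | hy
    · obtain ⟨d, rfl⟩ := hconv p i x hy h1.le
      exact hx' d c (hf.lt_iff_lt.1 h1) (hf.lt_iff_lt.1 h2) (hf.lt_iff_lt.1 h3) hxy
    · exact h.nonCrossing _ _ _ _ hy (hf hp) (hf hq) hxy hpq

/-! ### Splitting a graph into its two sides and its bridges -/

namespace IsGlueing

variable {l : A → W} {r : B → W} {g : E → W} {m : E} {G : SimpleGraph W}
  {U₁ : A → A → Prop} {U₂ : B → B → Prop} {U : W → W → Prop}

/-- An edge covering an endpoint of a bridge stays on its own side of `g m`, so it would cross the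
bridge. -/
theorem exists_of_bridge (h : IsGlueing l r g m (G.comap l) (G.comap r)) (hG : NonCrossing G)
    {u v : W} (hu : u < g m) (hv : g m < v) (huv : G.Adj u v) : (∃ x, g x = u) ∧ ∃ y, g y = v := by
  obtain ⟨a, rfl⟩ := (h.l_iff u).1 hu.le
  obtain ⟨b, rfl⟩ := (h.r_iff v).1 hv.le
  exact ⟨(h.gl_iff a).2 fun ⟨p, q, hp, hq, hpq⟩ =>
      hG _ _ _ _ (h.hl hp) (h.hl hq) ((h.l_le q).trans_lt hv) hpq huv,
    (h.gr_iff b).2 fun ⟨p, q, hp, hq, hpq⟩ =>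
      hG _ _ _ _ (hu.trans_le (h.le_r p)) (h.hr hp) (h.hr hq) huv hpq⟩

theorem sup_comap (h : IsGlueing l r g m (G.comap l) (G.comap r)) (hG : NonCrossing G) :
    (G.comap l).map l ⊔ (G.comap r).map r ⊔ (G.comap g).map g = G := by
  have key : ∀ u v, u < v → G.Adj u v →
      ((G.comap l).map l ⊔ (G.comap r).map r ⊔ (G.comap g).map g).Adj u v := by
    intro u v hlt huv
    rw [h.sup_adj]
    rcases le_or_gt v (g m) with hv | hv
    · obtain ⟨a, rfl⟩ := (h.l_iff u).1 (hlt.le.trans hv)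
      obtain ⟨b, rfl⟩ := (h.l_iff v).1 hv
      exact Or.inl ⟨a, b, huv, rfl, rfl⟩
    rcases le_or_gt (g m) u with hu | hu
    · obtain ⟨a, rfl⟩ := (h.r_iff u).1 hu
      obtain ⟨b, rfl⟩ := (h.r_iff v).1 hv.le
      exact Or.inr (Or.inl ⟨a, b, huv, rfl, rfl⟩)
    obtain ⟨⟨x, rfl⟩, ⟨y, rfl⟩⟩ := h.exists_of_bridge hG hu hv huv
    exact Or.inr (Or.inr ⟨x, y, huv, rfl, rfl⟩)
  ext u v
  constructor
  · rw [h.sup_adj]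
    rintro (⟨_, _, h1, rfl, rfl⟩ | ⟨_, _, h1, rfl, rfl⟩ | ⟨_, _, h1, rfl, rfl⟩) <;> exact h1
  · intro huv
    rcases huv.ne.lt_or_gt with h1 | h1
    · exact key u v h1 huv
    · exact (key v u h1 huv.symm).symm

theorem bridgeOrCovBy_of_adj (h : IsGlueing l r g m (G.comap l) (G.comap r)) {x y : E}
    (hxy : x < y) (hadj : G.Adj (g x) (g y)) : BridgeOrCovBy m x y := by
  rcases le_or_gt y m with hy | hy
  · obtain ⟨a, ha⟩ := (h.l_iff (g x)).1 (h.hg.monotone (hxy.le.trans hy))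
    obtain ⟨b, hb⟩ := (h.l_iff (g y)).1 (h.hg.monotone hy)
    exact Or.inl (h.covBy_of_adj_l hxy ha hb (by rwa [SimpleGraph.comap_adj, ha, hb]))
  rcases le_or_gt m x with hx | hx
  · obtain ⟨a, ha⟩ := (h.r_iff (g x)).1 (h.hg.monotone hx)
    obtain ⟨b, hb⟩ := (h.r_iff (g y)).1 (h.hg.monotone hy.le)
    exact Or.inl (h.covBy_of_adj_r hxy ha hb (by rwa [SimpleGraph.comap_adj, ha, hb]))
  exact Or.inr ⟨hx, hy⟩

/-- Maximality is inherited for bridges because vertices off the curve are covered by `G` anyway,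
and an edge of `G` crossing a candidate bridge must itself be a bridge: within one side it would
cover a hull vertex. -/
theorem isUpperTri_comap [Finite A] [Finite B] (h : IsGlueing l r g m (G.comap l) (G.comap r))
    (hG : IsUpperTri U G) (h₁ : IsUpperTri U₁ (G.comap l)) (hU₁ : ∀ i j, i ⋖ j → U₁ i j)
    (h₂ : IsUpperTri U₂ (G.comap r)) (hU₂ : ∀ i j, i ⋖ j → U₂ i j)
    (hU : ∀ u v, u < g m → g m < v → U u v) :
    IsUpperTri (BridgeOrCovBy m) (G.comap g) := by
  refine ⟨fun x y => h.bridgeOrCovBy_of_adj,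
    fun a b c d h1 h2 h3 => hG.nonCrossing _ _ _ _ (h.hg h1) (h.hg h2) (h.hg h3), ?_⟩
  intro x y hxy hUxy hcov hx hx'
  rcases hUxy with hc | ⟨hxm, hym⟩
  · rw [SimpleGraph.comap_adj]
    rcases le_or_gt y m with hy | hy
    · obtain ⟨a, ha⟩ := (h.l_iff (g x)).1 (h.hg.monotone (hxy.le.trans hy))
      obtain ⟨b, hb⟩ := (h.l_iff (g y)).1 (h.hg.monotone hy)
      rw [← ha, ← hb]
      exact h.adj_l_of_covBy h₁ hU₁ hc ha hb
    · have hx : m ≤ x := not_lt.1 fun hx => hc.2 hx hy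
      obtain ⟨a, ha⟩ := (h.r_iff (g x)).1 (h.hg.monotone hx)
      obtain ⟨b, hb⟩ := (h.r_iff (g y)).1 (h.hg.monotone hy.le)
      rw [← ha, ← hb]
      exact h.adj_r_of_covBy h₂ hU₂ hc ha hb
  refine hG.max _ _ (h.hg hxy) (hU _ _ (h.hg hxm) (h.hg hym)) ?_ ?_ ?_
  · intro k h1 h2
    by_cases hk : ∃ s, g s = k
    · obtain ⟨s, rfl⟩ := hk
      obtain ⟨p, q, hp, hq, hpq⟩ := hcov s (h.hg.lt_iff_lt.1 h1) (h.hg.lt_iff_lt.1 h2)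
      exact ⟨_, _, h.hg hp, h.hg hq, hpq⟩
    · rcases le_total k (g m) with hkm | hkm
      · obtain ⟨a, rfl⟩ := (h.l_iff k).1 hkm
        obtain ⟨p, q, hp, hq, hpq⟩ := not_not.1 (fun hn => hk ((h.gl_iff a).2 hn))
        exact ⟨_, _, h.hl hp, h.hl hq, hpq⟩
      · obtain ⟨a, rfl⟩ := (h.r_iff k).1 hkm
        obtain ⟨p, q, hp, hq, hpq⟩ := not_not.1 (fun hn => hk ((h.gr_iff a).2 hn))
        exact ⟨_, _, h.hr hp, h.hr hq, hpq⟩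
  · intro u v h1 h2 h3 huv
    rcases lt_or_ge u (g m) with hu | hu
    · obtain ⟨⟨p, rfl⟩, ⟨q, rfl⟩⟩ := h.exists_of_bridge hG.nonCrossing hu ((h.hg hym).trans h3) huv
      exact hx p q (h.hg.lt_iff_lt.1 h1) (h.hg.lt_iff_lt.1 h2) (h.hg.lt_iff_lt.1 h3) huv
    -- Here `uv` lies on the right side and would cover the hull vertex `g y`.
    · obtain ⟨p, rfl⟩ := (h.r_iff u).1 hu
      obtain ⟨q, rfl⟩ := (h.r_iff v).1 (hu.trans (h2.trans h3).le)
      obtain ⟨c, hc⟩ := (h.r_iff (g y)).1 (h.hg hym).le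
      rw [← hc, h.hr.lt_iff_lt] at h2 h3
      exact (h.gr_iff c).1 ⟨y, hc.symm⟩ ⟨p, q, h2, h3, huv⟩
  · intro u v h1 h2 h3 huv
    rcases lt_or_ge (g m) v with hv | hv
    · obtain ⟨⟨p, rfl⟩, ⟨q, rfl⟩⟩ := h.exists_of_bridge hG.nonCrossing (h1.trans (h.hg hxm)) hv huv
      exact hx' p q (h.hg.lt_iff_lt.1 h1) (h.hg.lt_iff_lt.1 h2) (h.hg.lt_iff_lt.1 h3) huv
    · obtain ⟨p, rfl⟩ := (h.l_iff u).1 ((h1.trans h2).le.trans hv)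
      obtain ⟨q, rfl⟩ := (h.l_iff v).1 hv
      obtain ⟨c, hc⟩ := (h.l_iff (g x)).1 (h.hg hxm).le
      rw [← hc, h.hl.lt_iff_lt] at h1 h2
      exact (h.gl_iff c).1 ⟨x, hc.symm⟩ ⟨p, q, h1, h2, huv⟩

end IsGlueing

/-! ### Triangles of a glued graph -/

theorem mem_image_cliqueSet_comap {A W : Type*} [DecidableEq W] {G : SimpleGraph W} {f : A → W} (hf : Function.Injective f)
    {k : ℕ} {s : Finset W} : s ∈ Finset.image f '' (G.comap f).cliqueSet k ↔
      s ∈ G.cliqueSet k ∧ ∀ w ∈ s, ∃ a, f a = w := by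
  simp only [Set.mem_image, SimpleGraph.mem_cliqueSet_iff, SimpleGraph.isNClique_iff]
  constructor
  · rintro ⟨t, ⟨ht, hc⟩, rfl⟩
    refine ⟨⟨?_, by rw [Finset.card_image_of_injective _ hf, hc]⟩, by simp⟩
    intro u hu v hv huv
    simp only [Finset.coe_image, Set.mem_image, Finset.mem_coe] at hu hv
    obtain ⟨a, ha, rfl⟩ := hu
    obtain ⟨b, hb, rfl⟩ := hv
    exact ht ha hb fun e => huv (e ▸ rfl)
  · rintro ⟨⟨hs, hc⟩, hr⟩
    have him : Finset.image f (s.preimage f hf.injOn) = s := by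
      ext w
      simp only [Finset.mem_image, Finset.mem_preimage]
      constructor
      · rintro ⟨a, ha, rfl⟩
        exact ha
      · intro hw
        obtain ⟨a, rfl⟩ := hr w hw
        exact ⟨a, hw, rfl⟩
    refine ⟨s.preimage f hf.injOn, ⟨?_, ?_⟩, him⟩
    · intro a ha b hb hab
      simp only [Finset.coe_preimage, Set.mem_preimage, Finset.mem_coe] at ha hb
      exact hs ha hb (hf.ne hab)
    · rw [← hc, ← Finset.card_image_of_injective _ hf, him]

namespace IsGlueing

variable {l : A → W} {r : B → W} {g : E → W} {m : E} {G : SimpleGraph W}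

/-- In a triangle with vertices on both sides of `g m`, every vertex other than `g m` is joined by a
bridge to a vertex on the opposite side, so it lies on the hull. -/
theorem cliqueSet_three (h : IsGlueing l r g m (G.comap l) (G.comap r)) (hG : NonCrossing G) :
    G.cliqueSet 3 = Finset.image l '' (G.comap l).cliqueSet 3 ∪
      Finset.image r '' (G.comap r).cliqueSet 3 ∪ Finset.image g '' (G.comap g).cliqueSet 3 := by
  ext s
  rw [Set.mem_union, Set.mem_union, mem_image_cliqueSet_comap h.hl.injective,
    mem_image_cliqueSet_comap h.hr.injective, mem_image_cliqueSet_comap h.hg.injective]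
  refine ⟨fun hs => ?_, fun hs => by tauto⟩
  by_cases h1 : ∀ w ∈ s, w ≤ g m
  · exact Or.inl (Or.inl ⟨hs, fun w hw => (h.l_iff w).1 (h1 w hw)⟩)
  by_cases h2 : ∀ w ∈ s, g m ≤ w
  · exact Or.inl (Or.inr ⟨hs, fun w hw => (h.r_iff w).1 (h2 w hw)⟩)
  push Not at h1 h2
  obtain ⟨c, hc, hmc⟩ := h1
  obtain ⟨a, ha, ham⟩ := h2
  refine Or.inr ⟨hs, fun w hw => ?_⟩
  have hcl := (SimpleGraph.mem_cliqueSet_iff.1 hs).isClique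
  rcases lt_trichotomy w (g m) with h3 | h3 | h3
  · exact (h.exists_of_bridge hG h3 hmc (hcl hw hc (h3.trans hmc).ne)).1
  · exact ⟨m, h3.symm⟩
  · exact (h.exists_of_bridge hG ham h3 (hcl ha hw (ham.trans h3).ne)).2

/-- The longest side of the triangle has the third vertex in between, so its ends are not neighbors
and it must be a bridge. This separates the triangles of the third kind from the others. -/
theorem exists_lt_gt_of_mem_cliqueSet (h : IsGlueing l r g m (G.comap l) (G.comap r)) {s : Finset W}
    (hs : s ∈ Finset.image g '' (G.comap g).cliqueSet 3) :
    (∃ w ∈ s, w < g m) ∧ ∃ w ∈ s, g m < w := by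
  obtain ⟨t, ht, rfl⟩ := hs
  rw [SimpleGraph.mem_cliqueSet_iff] at ht
  let e := t.orderEmbOfFin ht.card_eq
  have he : ∀ i, e i ∈ t := t.orderEmbOfFin_mem ht.card_eq
  have h01 : e 0 < e 1 := e.lt_iff_lt.2 (by decide)
  have h12 : e 1 < e 2 := e.lt_iff_lt.2 (by decide)
  rcases h.bridgeOrCovBy_of_adj (h01.trans h12) (ht.isClique (he 0) (he 2) (h01.trans h12).ne)
    with h3 | h3
  · exact (h3.2 h01 h12).elim
  · exact ⟨⟨_, Finset.mem_image_of_mem g (he 0), h.hg h3.1⟩,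
      ⟨_, Finset.mem_image_of_mem g (he 2), h.hg h3.2⟩⟩

theorem ncard_cliqueSet_three [Finite A] [Finite B] [Finite E]
    (h : IsGlueing l r g m (G.comap l) (G.comap r)) (hG : NonCrossing G) :
    (G.cliqueSet 3).ncard = ((G.comap l).cliqueSet 3).ncard + ((G.comap r).cliqueSet 3).ncard +
      ((G.comap g).cliqueSet 3).ncard := by
  rw [h.cliqueSet_three hG, Set.ncard_union_eq _ (Set.toFinite _) (Set.toFinite _),
    Set.ncard_union_eq _ (Set.toFinite _) (Set.toFinite _),
    Set.ncard_image_of_injective _ (Finset.image_injective h.hl.injective),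
    Set.ncard_image_of_injective _ (Finset.image_injective h.hr.injective),
    Set.ncard_image_of_injective _ (Finset.image_injective h.hg.injective)]
  · rw [Set.disjoint_left]
    intro s hs hs'
    rw [mem_image_cliqueSet_comap h.hl.injective] at hs
    rw [mem_image_cliqueSet_comap h.hr.injective] at hs'
    -- The two sides share only the vertex `g m`, too little for a triangle.
    have h1 : s ⊆ {g m} := fun w hw => by
      rw [Finset.mem_singleton]
      exact le_antisymm ((h.l_iff w).2 (hs.2 w hw)) ((h.r_iff w).2 (hs'.2 w hw))
    have h2 := Finset.card_le_card h1
    rw [(SimpleGraph.mem_cliqueSet_iff.1 hs.1).card_eq, Finset.card_singleton] at h2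
    omega
  · rw [Set.disjoint_left]
    intro s hs hs'
    obtain ⟨⟨u, hu, hum⟩, ⟨v, hv, hvm⟩⟩ := h.exists_lt_gt_of_mem_cliqueSet hs'
    rcases hs with hs | hs
    · rw [mem_image_cliqueSet_comap h.hl.injective] at hs
      exact hvm.not_ge ((h.l_iff v).2 (hs.2 v hv))
    · rw [mem_image_cliqueSet_comap h.hr.injective] at hs
      exact hum.not_ge ((h.r_iff u).2 (hs.2 u hu))

end IsGlueing

end Glueing

/-! ### Crossings of upper edges -/

namespace Chain

variable {n : ℕ}

/-- Chain edges and upper edges. -/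
def Admissible (C : Chain n) (i j : Fin (n + 1)) : Prop := C.IsChainEdge i j ∨ C.IsUpperEdge i j

theorem admissible_of_covBy (C : Chain n) (i j : Fin (n + 1)) (h : i ⋖ j) : C.Admissible i j := by
  rw [Fin.covBy_iff, Nat.covBy_iff_add_one_eq] at h
  exact Or.inl h

/-- Positive orientation puts the middle point below the edge. All geometric facts about admissible
edges come from this sign. -/
theorem Admissible.orient_pos {C : Chain n} {i j k : Fin (n + 1)} (h : C.Admissible i k)
    (hij : i < j) (hjk : j < k) : 0 < orient (C.pt i) (C.pt j) (C.pt k) := by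
  rcases h with h | h
  · unfold IsChainEdge at h
    rw [Fin.lt_def] at hij hjk
    omega
  · refine (C.orient_ne_zero hij hjk).lt_or_gt.resolve_left fun hneg => ?_
    have := (C.vis_eq hij hjk).2 hneg
    rw [h.2] at this
    norm_num at this

theorem Admissible.orient_nonneg {C : Chain n} {i j k : Fin (n + 1)} (h : C.Admissible i k)
    (hij : i ≤ j) (hjk : j ≤ k) : 0 ≤ orient (C.pt i) (C.pt j) (C.pt k) := by
  rcases hij.eq_or_lt with rfl | hij
  · rw [orient_left]
  rcases hjk.eq_or_lt with rfl | hjk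
  · rw [orient_right]
  exact (h.orient_pos hij hjk).le

theorem fst_mem_of_mem_segment (C : Chain n) {i j : Fin (n + 1)} (h : i < j) {z : ℝ × ℝ}
    (hz : z ∈ segment ℝ (C.pt i) (C.pt j)) : (C.pt i).1 ≤ z.1 ∧ z.1 ≤ (C.pt j).1 := by
  obtain ⟨t, h0, h1, e1, -⟩ := mem_segment_prod.1 hz
  have := C.strictMono_fst h
  simp only at this
  constructor <;> nlinarith

theorem eq_left_of_fst_eq (C : Chain n) {i j : Fin (n + 1)} (h : i < j) {z : ℝ × ℝ}
    (hz : z ∈ segment ℝ (C.pt i) (C.pt j)) (he : z.1 = (C.pt i).1) : z = C.pt i := by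
  obtain ⟨t, h0, h1, e1, e2⟩ := mem_segment_prod.1 hz
  have := C.strictMono_fst h
  simp only at this
  have ht : t = 0 := by
    have : t * ((C.pt j).1 - (C.pt i).1) = 0 := by linarith
    rcases mul_eq_zero.1 this with h | h <;> linarith
  subst ht
  ext <;> linarith

theorem eq_right_of_fst_eq (C : Chain n) {i j : Fin (n + 1)} (h : i < j) {z : ℝ × ℝ}
    (hz : z ∈ segment ℝ (C.pt i) (C.pt j)) (he : z.1 = (C.pt j).1) : z = C.pt j := by
  obtain ⟨t, h0, h1, e1, e2⟩ := mem_segment_prod.1 hz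
  have := C.strictMono_fst h
  simp only at this
  have ht : t = 1 := by
    have : (1 - t) * ((C.pt j).1 - (C.pt i).1) = 0 := by linarith
    rcases mul_eq_zero.1 this with h | h <;> linarith
  subst ht
  ext <;> linarith

/-- Interleaved admissible edges intersect. -/
theorem exists_mem_segment_inter (C : Chain n) {a b c d : Fin (n + 1)} (hac : a < c) (hcb : c < b)
    (hbd : b < d) (hab : C.Admissible a b) (hcd : C.Admissible c d) :
    ∃ z, z ∈ segment ℝ (C.pt a) (C.pt b) ∩ segment ℝ (C.pt c) (C.pt d) := by
  have hu := hab.orient_pos hac hcb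
  have hw := hcd.orient_pos hcb hbd
  have x1 := C.strictMono_fst hac
  have x2 := C.strictMono_fst hcb
  have x3 := C.strictMono_fst hbd
  simp only at x1 x2 x3
  generalize C.pt a = a at *
  generalize C.pt b = b at *
  generalize C.pt c = c at *
  generalize C.pt d = d at *
  have hba : 0 < b.1 - a.1 := by linarith
  have hdc : 0 < d.1 - c.1 := by linarith
  set u := orient a c b with hu'
  set w := orient c b d
  -- `q` is the point of `ab` vertically above `c`. It lies above `cd`, whereas `b` lies below `cd`.
  let q : ℝ × ℝ := (c.1, c.2 + u / (b.1 - a.1))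
  have hq1 : orient a q b = 0 := by
    simp only [q, orient, hu']
    field_simp
    ring
  set k := u * (d.1 - c.1) / (b.1 - a.1) with hk
  have hq2 : orient c q d = -k := by
    simp only [q, orient, hk]
    field_simp
    ring
  have hk0 : 0 < k := by positivity
  -- Along `qb` the orientation with respect to `cd` is affine, with values `-k` at `q` and `w` at
  -- `b`; this is its zero.
  set t := k / (k + w) with ht
  have ht0 : 0 < t := by positivity
  have ht1 : t < 1 := by
    rw [ht, div_lt_one (by positivity)]
    linarith
  let z : ℝ × ℝ := ((1 - t) * q.1 + t * b.1, (1 - t) * q.2 + t * b.2)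
  have hz1 : c.1 ≤ z.1 := by
    simp only [z, q]
    nlinarith
  have hz2 : z.1 ≤ b.1 := by
    simp only [z, q]
    nlinarith
  refine ⟨z, mem_segment_of_orient (by linarith) (by linarith) hz2 ?_,
    mem_segment_of_orient (by linarith) hz1 (by linarith) ?_⟩
  · rw [orient_lerp (t := t) (u := q) (v := b) rfl rfl, hq1, orient_right]
    ring
  · rw [orient_lerp (t := t) (u := q) (v := b) rfl rfl, hq2, ht]
    field_simp
    ring

/-- An admissible edge meets an edge spanned by vertices below it at most in a common endpoint. -/
theorem nested_inter (C : Chain n) {a b c d : Fin (n + 1)} (hac : a ≤ c) (hcd : c < d) (hdb : d ≤ b)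
    (hab : C.Admissible a b) (hne : ¬ (a = c ∧ b = d)) {z : ℝ × ℝ}
    (hz : z ∈ segment ℝ (C.pt a) (C.pt b)) (hz' : z ∈ segment ℝ (C.pt c) (C.pt d)) :
    ∃ v, v ∈ s(a, b) ∧ v ∈ s(c, d) ∧ z = C.pt v := by
  have h0 := orient_of_mem_segment hz
  obtain ⟨t, ht0, ht1, e1, e2⟩ := mem_segment_prod.1 hz'
  rw [orient_lerp e1 e2] at h0
  have hc := hab.orient_nonneg hac (hcd.le.trans hdb)
  have hd := hab.orient_nonneg (hac.trans hcd.le) hdb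
  -- The orientation with respect to `ab` is nonnegative at `c` and `d` and vanishes at `z` between
  -- them, so both weighted terms vanish. It is positive at any of `c`, `d` that is not an end of
  -- `ab`.
  have m1 := mul_nonneg (sub_nonneg.2 ht1) hc
  have m2 := mul_nonneg ht0 hd
  have z1 : (1 - t) * orient (C.pt a) (C.pt c) (C.pt b) = 0 := by linarith
  have z2 : t * orient (C.pt a) (C.pt d) (C.pt b) = 0 := by linarith
  rcases hac.eq_or_lt with rfl | hac
  · have hdb : d < b := lt_of_le_of_ne hdb fun e => hne ⟨rfl, e.symm⟩
    rcases mul_eq_zero.1 z2 with rfl | h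
    · exact ⟨a, by simp, by simp, by ext <;> linarith⟩
    · exact ((hab.orient_pos hcd hdb).ne' h).elim
  · rcases mul_eq_zero.1 z1 with h | h
    · obtain rfl : t = 1 := by linarith
      have hzd : z = C.pt d := by ext <;> linarith
      rcases hdb.eq_or_lt with rfl | hdb
      · exact ⟨d, by simp, by simp, hzd⟩
      · rcases mul_eq_zero.1 z2 with h | h
        · norm_num at h
        · exact ((hab.orient_pos (hac.trans hcd) hdb).ne' h).elim
    · exact ((hab.orient_pos hac (hcd.trans_le hdb)).ne' h).elim

/-- Admissible edges that are not interleaved meet at most in a common endpoint. -/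
theorem inter_of_not_interleaved (C : Chain n) {a b c d : Fin (n + 1)} (hlt : a < b) (hlt' : c < d)
    (hab : C.Admissible a b) (hcd : C.Admissible c d) (hne : ¬ (a = c ∧ b = d))
    (h1 : ¬ (a < c ∧ c < b ∧ b < d)) (h2 : ¬ (c < a ∧ a < d ∧ d < b)) {z : ℝ × ℝ}
    (hz : z ∈ segment ℝ (C.pt a) (C.pt b)) (hz' : z ∈ segment ℝ (C.pt c) (C.pt d)) :
    ∃ v, v ∈ s(a, b) ∧ v ∈ s(c, d) ∧ z = C.pt v := by
  have b1 := C.fst_mem_of_mem_segment hlt hz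
  have b2 := C.fst_mem_of_mem_segment hlt' hz'
  rcases le_or_gt b c with h | h
  · have := C.strictMono_fst.monotone h
    have e : (C.pt b).1 = (C.pt c).1 := by linarith
    have := C.strictMono_fst.injective e
    subst this
    exact ⟨b, by simp, by simp, C.eq_right_of_fst_eq hlt hz (by linarith)⟩
  rcases le_or_gt d a with h' | h'
  · have := C.strictMono_fst.monotone h'
    have e : (C.pt d).1 = (C.pt a).1 := by linarith
    have := C.strictMono_fst.injective e
    subst this
    exact ⟨d, by simp, by simp, C.eq_left_of_fst_eq hlt hz (by linarith)⟩
  by_cases h3 : a ≤ c ∧ d ≤ b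
  · exact C.nested_inter h3.1 hlt' h3.2 hab hne hz hz'
  · have h4 : c ≤ a ∧ b ≤ d := by
      constructor <;> by_contra h5 <;> grind
    obtain ⟨v, q1, q2, q3⟩ := C.nested_inter h4.1 hlt h4.2 hcd (fun e => hne ⟨e.1.symm, e.2.symm⟩)
      hz' hz
    exact ⟨v, q2, q1, q3⟩

/-- Interleaved edges have four distinct endpoints yet intersect; in every other position the index
intervals are nested, or they overlap in at most an endpoint. -/
theorem crossingFree_iff (C : Chain n) {G : SimpleGraph (Fin (n + 1))}
    (hG : ∀ i j, i < j → G.Adj i j → C.Admissible i j) : CrossingFree C.pt G ↔ NonCrossing G := by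
  constructor
  · intro h a b c d hac hcb hbd hab hcd
    obtain ⟨z, hz⟩ := C.exists_mem_segment_inter hac hcb hbd (hG _ _ (hac.trans hcb) hab)
      (hG _ _ (hcb.trans hbd) hcd)
    obtain ⟨v, h1, h2, -⟩ := h a b c d hab hcd (by
      intro e
      rw [Sym2.eq_iff] at e
      rcases e with e | e
      · exact hac.ne e.1
      · exact (hac.trans (hcb.trans hbd)).ne e.1) z hz
    rw [Sym2.mem_iff] at h1 h2
    grind
  · intro h
    have key : ∀ a b c d, a < b → c < d → G.Adj a b → G.Adj c d → s(a, b) ≠ s(c, d) →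
        ∀ z ∈ segment ℝ (C.pt a) (C.pt b) ∩ segment ℝ (C.pt c) (C.pt d),
          ∃ v, v ∈ s(a, b) ∧ v ∈ s(c, d) ∧ z = C.pt v := fun a b c d hab hcd h1 h2 hs z hz =>
      C.inter_of_not_interleaved hab hcd (hG _ _ hab h1) (hG _ _ hcd h2)
        (by rintro ⟨rfl, rfl⟩; exact hs rfl)
        (fun q => h a b c d q.1 q.2.1 q.2.2 h1 h2) (fun q => h c d a b q.1 q.2.1 q.2.2 h2 h1)
        hz.1 hz.2
    have key' : ∀ a b c d, a < b → G.Adj a b → G.Adj c d → s(a, b) ≠ s(c, d) →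
        ∀ z ∈ segment ℝ (C.pt a) (C.pt b) ∩ segment ℝ (C.pt c) (C.pt d),
          ∃ v, v ∈ s(a, b) ∧ v ∈ s(c, d) ∧ z = C.pt v := by
      intro a b c d hab h1 h2 hs
      rcases h2.ne.lt_or_gt with hcd | hcd
      · exact key a b c d hab hcd h1 h2 hs
      · rw [Sym2.eq_swap (a := c), segment_symm ℝ (C.pt c)] at *
        exact key a b d c hab hcd h1 h2.symm hs
    intro a b c d h1 h2 hs
    rcases h1.ne.lt_or_gt with hab | hab
    · exact key' a b c d hab h1 h2 hs
    · rw [Sym2.eq_swap (a := a), segment_symm ℝ (C.pt a)] at *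
      exact key' b a c d hab h1.symm h2 hs

end Chain

/-! ### The area below a curve of visible edges -/

theorem exists_consecutive_of_not_mem {n : ℕ} {S : Finset (Fin (n + 1))} (h0 : 0 ∈ S)
    (hl : Fin.last n ∈ S) {k : Fin (n + 1)} (hk : k ∉ S) :
    ∃ i j, Consecutive S i j ∧ i < k ∧ k < j := by
  have hk0 : 0 < k := Fin.pos_iff_ne_zero.2 fun e => hk (e ▸ h0)
  have hkl : k < Fin.last n := lt_of_le_of_ne (Fin.le_last k) fun e => hk (e ▸ hl)
  obtain ⟨i, hi, hmax⟩ := (S.filter (· < k)).exists_max_image id ⟨0, by simp [h0, hk0]⟩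
  obtain ⟨j, hj, hmin⟩ := (S.filter (k < ·)).exists_min_image id ⟨_, Finset.mem_filter.2 ⟨hl, hkl⟩⟩
  simp only [Finset.mem_filter, id, and_imp] at hi hj hmax hmin
  refine ⟨i, j, ⟨hi.1, hj.1, hi.2.trans hj.2, fun x hx hxij => ?_⟩, hi.2, hj.2⟩
  rcases lt_trichotomy x k with h | rfl | h
  · exact hxij.1.not_ge (hmax x hx h)
  · exact hk hx
  · exact hxij.2.not_ge (hmin x hx h)

theorem exists_consecutive_right {n : ℕ} {S : Finset (Fin (n + 1))} {i k : Fin (n + 1)} (hi : i ∈ S)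
    (hk : k ∈ S) (hik : i < k) : ∃ j, Consecutive S i j := by
  obtain ⟨j, hj, hmin⟩ := (S.filter (i < ·)).exists_min_image id ⟨k, by simp [hk, hik]⟩
  simp only [Finset.mem_filter, id, and_imp] at hj hmin
  exact ⟨j, hi, hj.1, hj.2, fun x hx hxij => hxij.2.not_ge (hmin x hx hxij.1)⟩

namespace Chain

variable {n : ℕ}

/-- An edge passing over a visible vertex is strictly above the curve there. Otherwise its span lies
within that of a single visible edge, its endpoints are on or below that edge, and so is the whole
segment. -/
theorem below_polyline_iff (C : Chain n) {S : Finset (Fin (n + 1))} (hl : Fin.last n ∈ S)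
    (hS : ∀ i j, Consecutive S i j → C.Admissible i j) {i j : Fin (n + 1)} (hij : i < j)
    (hadm : C.Admissible i j) :
    (∀ z ∈ segment ℝ (C.pt i) (C.pt j), ∀ w ∈ C.polyline S, w.1 = z.1 → z.2 ≤ w.2) ↔
      ∀ s ∈ S, ¬ (i < s ∧ s < j) := by
  -- For `w` on the line `ac` and `z` at the same abscissa, the orientation measures the vertical
  -- gap between them.
  have height : ∀ {a c z w : ℝ × ℝ}, orient a w c = 0 → z.1 = w.1 →
      orient a z c = (w.2 - z.2) * (c.1 - a.1) := by
    intro a c z w h0 e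
    rw [← sub_zero (orient a z c), ← h0]
    simp only [orient, e]
    ring
  constructor
  · rintro h s hs ⟨his, hsj⟩
    obtain ⟨t, ht⟩ := exists_consecutive_right hs hl (hsj.trans_le (Fin.le_last j))
    have x1 := C.strictMono_fst his
    have x2 := C.strictMono_fst hsj
    simp only at x1 x2
    have hpos := hadm.orient_pos his hsj
    have hji : 0 < (C.pt j).1 - (C.pt i).1 := by linarith
    -- The point of the edge `ij` vertically above the visible vertex `s`.
    let z : ℝ × ℝ := ((C.pt s).1,
      (C.pt s).2 + orient (C.pt i) (C.pt s) (C.pt j) / ((C.pt j).1 - (C.pt i).1))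
    have hz : z ∈ segment ℝ (C.pt i) (C.pt j) := by
      refine mem_segment_of_orient (by linarith) x1.le x2.le ?_
      simp only [z, orient]
      field_simp
      ring
    have h1 := h z hz (C.pt s) ⟨s, t, ht, left_mem_segment ℝ _ _⟩ rfl
    have h2 := div_pos hpos hji
    simp only [z] at h1
    linarith
  · rintro h z hz w ⟨s, t, hst, hw⟩ e
    have b1 := C.fst_mem_of_mem_segment hij hz
    have b2 := C.fst_mem_of_mem_segment hst.2.2.1 hw
    rcases le_or_gt t i with h1 | h1
    · have := C.strictMono_fst.monotone h1
      have e' : (C.pt t).1 = (C.pt i).1 := by linarith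
      have := C.strictMono_fst.injective e'
      subst this
      rw [C.eq_left_of_fst_eq hij hz (by linarith),
        C.eq_right_of_fst_eq hst.2.2.1 hw (by linarith)]
    rcases le_or_gt j s with h2 | h2
    · have := C.strictMono_fst.monotone h2
      have e' : (C.pt j).1 = (C.pt s).1 := by linarith
      have := C.strictMono_fst.injective e'
      subst this
      rw [C.eq_right_of_fst_eq hij hz (by linarith),
        C.eq_left_of_fst_eq hst.2.2.1 hw (by linarith)]
    have hsi : s ≤ i := not_lt.1 fun q => h s hst.1 ⟨q, h2⟩
    have hjt : j ≤ t := not_lt.1 fun q => h t hst.2.1 ⟨h1, q⟩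
    have x := C.strictMono_fst hst.2.2.1
    simp only at x
    obtain ⟨r, hr0, hr1, e1, e2⟩ := mem_segment_prod.1 hz
    have o := height (orient_of_mem_segment hw) e.symm
    rw [orient_lerp e1 e2] at o
    have o1 := mul_nonneg (sub_nonneg.2 hr1) ((hS s t hst).orient_nonneg hsi (hij.le.trans hjt))
    have o2 := mul_nonneg hr0 ((hS s t hst).orient_nonneg (hsi.trans hij.le) hjt)
    have := nonneg_of_mul_nonneg_left (a := w.2 - z.2) (by linarith) (sub_pos.2 x)
    linarith

/-- From here on, coordinates are no longer needed. -/
theorem isDrawnBelow_iff (C : Chain n) {S : Finset (Fin (n + 1))} (hl : Fin.last n ∈ S)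
    (hS : ∀ i j, Consecutive S i j → C.Admissible i j) {G : SimpleGraph (Fin (n + 1))} :
    C.IsDrawnBelow S G ↔ (∀ i j, i < j → G.Adj i j → C.Admissible i j) ∧ NonCrossing G ∧
      ∀ s ∈ S, ¬ Covered G s := by
  constructor
  · rintro ⟨h1, h2⟩
    have h3 : ∀ i j, i < j → G.Adj i j → C.Admissible i j := fun i j hij h => (h2 i j hij h).1
    refine ⟨h3, (C.crossingFree_iff h3).1 h1, ?_⟩
    rintro s hs ⟨i, j, his, hsj, hadj⟩
    have hij := his.trans hsj
    exact (C.below_polyline_iff hl hS hij (h3 i j hij hadj)).1 (h2 i j hij hadj).2 s hs ⟨his, hsj⟩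
  · rintro ⟨h1, h2, h3⟩
    refine ⟨(C.crossingFree_iff h1).2 h2, fun i j hij hadj => ⟨h1 i j hij hadj, ?_⟩⟩
    exact (C.below_polyline_iff hl hS hij (h1 i j hij hadj)).2
      fun s hs q => h3 s hs ⟨i, j, q.1, q.2, hadj⟩

end Chain

/-! ### Partial upper triangulations as maximal non-crossing graphs -/

namespace PartialUpperTriangulation

variable {n : ℕ} {C : Chain n}

/-- A vertex skipped by the visible curve is covered by the visible edge passing over it. -/
theorem mem_visible_iff (T : PartialUpperTriangulation C) (s : Fin (n + 1)) :
    s ∈ T.visible ↔ ¬ Covered T.graph s := by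
  refine ⟨((C.isDrawnBelow_iff T.last_mem T.visible_edge).1 T.maximal.prop).2.2 s, fun h => ?_⟩
  by_contra hs
  obtain ⟨i, j, hc, hi, hj⟩ := exists_consecutive_of_not_mem T.zero_mem T.last_mem hs
  exact h ⟨i, j, hi, hj, T.visible_adj i j hc⟩

theorem ext_graph {T T' : PartialUpperTriangulation C} (h : T.graph = T'.graph) : T = T' := by
  have hv : T.visible = T'.visible := by
    ext s
    rw [mem_visible_iff, mem_visible_iff, h]
  cases T
  cases T'
  simp only at h hv
  subst h hv
  rfl

theorem isUpperTri (T : PartialUpperTriangulation C) : IsUpperTri C.Admissible T.graph := by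
  have hd := fun {G} => C.isDrawnBelow_iff (G := G) T.last_mem T.visible_edge
  obtain ⟨h1, h2, h3⟩ := hd.1 T.maximal.prop
  refine ⟨h1, h2, fun i j hij hadm hcov hx hx' => ?_⟩
  have hadj : ∀ {a b}, a < b → (T.graph ⊔ SimpleGraph.edge i j).Adj a b →
      T.graph.Adj a b ∨ (a = i ∧ b = j) := by
    intro a b hab h
    rw [SimpleGraph.sup_adj, SimpleGraph.edge_adj] at h
    rcases h with h | ⟨⟨rfl, rfl⟩ | ⟨rfl, rfl⟩, -⟩
    · exact Or.inl h
    · exact Or.inr ⟨rfl, rfl⟩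
    · exact (hab.not_gt hij).elim
  -- Inserting `ij` covers only vertices that were covered before, so no visible vertex becomes
  -- hidden.
  have hP : C.IsDrawnBelow T.visible (T.graph ⊔ SimpleGraph.edge i j) := by
    refine hd.2 ⟨?_, ?_, ?_⟩
    · intro a b hab h
      rcases hadj hab h with h | ⟨rfl, rfl⟩
      · exact h1 a b hab h
      · exact hadm
    · intro a b c d hac hcb hbd hab hcd
      rcases hadj (hac.trans hcb) hab with e₁ | ⟨rfl, rfl⟩ <;>
        rcases hadj (hcb.trans hbd) hcd with e₂ | ⟨rfl, rfl⟩
      · exact h2 a b c d hac hcb hbd e₁ e₂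
      · exact hx' _ _ hac hcb hbd e₁
      · exact hx _ _ hac hcb hbd e₂
      · exact hac.ne rfl
    · rintro s hs ⟨a, b, has, hsb, hab⟩
      rcases hadj (has.trans hsb) hab with hab | ⟨rfl, rfl⟩
      · exact h3 s hs ⟨a, b, has, hsb, hab⟩
      · exact h3 s hs (hcov s has hsb)
  refine T.maximal.le_of_ge hP le_sup_left ?_
  rw [SimpleGraph.sup_adj, SimpleGraph.edge_adj]
  exact Or.inr ⟨Or.inl ⟨rfl, rfl⟩, hij.ne⟩

-- The visible curve has to run through the uncovered vertices; consecutive ones are adjacent by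
-- `NonCrossing.adj_of_not_covered`.
open Classical in
theorem exists_of_isUpperTri {G : SimpleGraph (Fin (n + 1))} (h : IsUpperTri C.Admissible G) :
    ∃ T : PartialUpperTriangulation C, T.graph = G := by
  let S : Finset (Fin (n + 1)) := Finset.univ.filter fun s => ¬ Covered G s
  have hmem : ∀ s, s ∈ S ↔ ¬ Covered G s := fun s => by simp [S]
  have h0 : 0 ∈ S := (hmem _).2 fun ⟨i, _, hi, _⟩ => (Fin.not_lt_zero i hi).elim
  have hl : Fin.last n ∈ S := (hmem _).2 fun ⟨_, j, _, hj, _⟩ => (Fin.le_last j).not_gt hj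
  have hcov := fun i j => h.adj_of_covBy C.admissible_of_covBy (i := i) (j := j)
  have hadj : ∀ i j, Consecutive S i j → G.Adj i j := fun i j hij =>
    h.nonCrossing.adj_of_not_covered hcov hij.2.2.1 ((hmem i).1 hij.1) ((hmem j).1 hij.2.1)
      fun k h1 h2 => by
        by_contra hk
        exact hij.2.2.2 k ((hmem k).2 hk) ⟨h1, h2⟩
  have hS : ∀ i j, Consecutive S i j → C.Admissible i j :=
    fun i j hij => h.adm i j hij.2.2.1 (hadj i j hij)
  refine ⟨⟨G, S, h0, hl, hS, fun i => hcov _ _ ?_, hadj, ?_, ?_⟩, rfl⟩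
  · rw [Fin.covBy_iff, Nat.covBy_iff_add_one_eq]
    simp
  · exact (C.isDrawnBelow_iff hl hS).2 ⟨h.adm, h.nonCrossing, fun s => (hmem s).1⟩
  · intro H hH hGH
    obtain ⟨h1, h2, h3⟩ := (C.isDrawnBelow_iff hl hS).1 hH
    -- An edge of a larger admitted graph `H` passes over no vertex of `S`, so everything below it
    -- is covered in `G`, and `IsUpperTri.max` applies to it.
    have key : ∀ a b, a < b → H.Adj a b → G.Adj a b := fun a b hab hadj =>
      h.max a b hab (h1 a b hab hadj)
        (fun k hk1 hk2 => by
          by_contra hk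
          exact h3 k ((hmem k).2 hk) ⟨a, b, hk1, hk2, hadj⟩)
        (fun x y q1 q2 q3 q4 => h2 a b x y q1 q2 q3 hadj (hGH q4))
        (fun x y q1 q2 q3 q4 => h2 x y a b q1 q2 q3 (hGH q4) hadj)
    intro a b hab
    rcases hab.ne.lt_or_gt with q | q
    · exact key a b q hab
    · exact (key b a q hab.symm).symm

end PartialUpperTriangulation

/-! ### Visibility in sums of chains -/

theorem inl_strictMono {n₁ n₂ : ℕ} : StrictMono (inl : Fin (n₁ + 1) → Fin (n₁ + n₂ + 1)) :=
  fun _ _ h => h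

theorem inr_strictMono {n₁ n₂ : ℕ} : StrictMono (inr : Fin (n₂ + 1) → Fin (n₁ + n₂ + 1)) :=
  fun i j h => by
    rw [Fin.lt_def] at h ⊢
    simpa [inr] using h

theorem exists_inl {n₁ n₂ : ℕ} {l : Fin (n₁ + n₂ + 1)} (hl : (l : ℕ) ≤ n₁) :
    ∃ i : Fin (n₁ + 1), inl i = l := ⟨⟨l, by omega⟩, rfl⟩

theorem exists_inr {n₁ n₂ : ℕ} {l : Fin (n₁ + n₂ + 1)} (hl : n₁ ≤ (l : ℕ)) :
    ∃ i : Fin (n₂ + 1), inr i = l := ⟨⟨l - n₁, by omega⟩, Fin.ext (by simp [inr]; omega)⟩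

theorem inl_last {n₁ n₂ : ℕ} : (inl (Fin.last n₁) : Fin (n₁ + n₂ + 1)) = inr 0 :=
  Fin.ext (by simp [inl, inr])

theorem IsSum.congr {n₁ n₂ : ℕ} {s : ℤ} {C₁ : Chain n₁} {C₂ : Chain n₂} {C C' : Chain (n₁ + n₂)}
    (h : IsSum s C₁ C₂ C) (hC : C' ≈ C) : IsSum s C₁ C₂ C' :=
  ⟨fun i j hij => (hC _ _ (inl_strictMono hij)).trans (h.1 i j hij),
    fun i j hij => (hC _ _ (inr_strictMono hij)).trans (h.2.1 i j hij),
    fun i j hi hj => (hC i j (Fin.lt_def.2 (hi.trans hj))).trans (h.2.2 i j hi hj)⟩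

namespace Chain

theorem vis_concave : ∀ (n : ℕ) (i j : Fin (n + 1)), (i : ℕ) + 1 < j → (concave n).vis i j = -1
  | 0, i, j, h => by omega
  | 1, i, j, h => by omega
  | n + 2, i, j, h => by
    have hs : IsSum (-1) (concave (n + 1)) primitive (concave (n + 2)) :=
      concaveSum_spec (n₁ := n + 1) (n₂ := 1) (concave (n + 1)) primitive
    rcases le_or_gt (j : ℕ) (n + 1) with hj | hj
    · obtain ⟨b, rfl⟩ := exists_inl (n₁ := n + 1) (n₂ := 1) hj
      obtain ⟨a, rfl⟩ := exists_inl (n₁ := n + 1) (n₂ := 1) (l := i) (by omega)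
      have hab : (a : ℕ) + 1 < b := h
      exact (hs.1 a b (Fin.lt_def.2 (by omega))).trans (vis_concave (n + 1) a b hab)
    -- Here `j` is the last point and `i` is not its neighbor, so this is a bridging entry of the
    -- last concave sum.
    · exact hs.2.2 i j (by omega) hj

variable {n₁ n₂ : ℕ} {C₁ : Chain n₁} {C₂ : Chain n₂} {C : Chain (n₁ + n₂)}

theorem admissible_inl_iff {s : ℤ} (h : IsSum s C₁ C₂ C) {i j : Fin (n₁ + 1)} (hij : i < j) :
    C.Admissible (inl i) (inl j) ↔ C₁.Admissible i j := by
  simp only [Admissible, IsChainEdge, IsUpperEdge, h.1 i j hij, hij, inl_strictMono hij]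
  simp [inl]

theorem admissible_inr_iff {s : ℤ} (h : IsSum s C₁ C₂ C) {i j : Fin (n₂ + 1)} (hij : i < j) :
    C.Admissible (inr i) (inr j) ↔ C₂.Admissible i j := by
  simp only [Admissible, IsChainEdge, IsUpperEdge, h.2.1 i j hij, hij, inr_strictMono hij]
  simp [inr, add_assoc]

theorem admissible_of_lt_of_gt (h : IsSum 1 C₁ C₂ C) {i j : Fin (n₁ + n₂ + 1)} (hi : (i : ℕ) < n₁)
    (hj : n₁ < (j : ℕ)) : C.Admissible i j :=
  Or.inr ⟨Fin.lt_def.2 (hi.trans hj), h.2.2 i j hi hj⟩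

/-- The upper edges of a convex sum of two concave chains are the bridging edges. -/
theorem admissible_concave_iff {v₁ v₂ : ℕ} {D : Chain (v₁ + v₂)}
    (h : IsSum 1 (concave v₁) (concave v₂) D) {i j : Fin (v₁ + v₂ + 1)} (hij : i < j) :
    D.Admissible i j ↔ BridgeOrCovBy (inl (Fin.last v₁)) i j := by
  have hcov : D.IsChainEdge i j ↔ i ⋖ j := by
    rw [Fin.covBy_iff, Nat.covBy_iff_add_one_eq]
    rfl
  unfold Admissible BridgeOrCovBy
  rw [hcov]
  by_cases hc : i ⋖ j
  · simp [hc]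
  have hlt : (i : ℕ) + 1 < j := by
    have h1 : (i : ℕ) + 1 ≠ j := fun e => hc (hcov.1 e)
    rw [Fin.lt_def] at hij
    omega
  simp only [hc, false_or, IsUpperEdge, hij, true_and, Fin.lt_def, inl, Fin.val_last]
  refine ⟨fun hv => ?_, fun hv => h.2.2 i j hv.1 hv.2⟩
  by_contra hn
  rcases le_or_gt (j : ℕ) v₁ with hj | hj
  · obtain ⟨b, rfl⟩ := exists_inl hj
    obtain ⟨a, rfl⟩ := exists_inl (l := i) (by omega)
    have hab : (a : ℕ) + 1 < b := hlt
    rw [h.1 a b (Fin.lt_def.2 (by omega)), vis_concave v₁ a b hab] at hv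
    norm_num at hv
  · obtain ⟨b, rfl⟩ := exists_inr hj.le
    obtain ⟨a, rfl⟩ := exists_inr (l := i) (by omega)
    have hab : (a : ℕ) + 1 < b := by
      simp only [inr] at hlt
      omega
    rw [h.2.1 a b (Fin.lt_def.2 (by omega)), vis_concave v₂ a b hab] at hv
    norm_num at hv

end Chain

/-! ### The concatenated curve of visible edges -/

namespace PartialUpperTriangulation

variable {n : ℕ} {C : Chain n}

theorem visibleVertex_strictMono (T : PartialUpperTriangulation C) : StrictMono T.visibleVertex :=
  (T.visible.orderEmbOfFin T.card_visible).strictMono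

theorem exists_visibleVertex_iff (T : PartialUpperTriangulation C) (s : Fin (n + 1)) :
    (∃ l, T.visibleVertex l = s) ↔ ¬ Covered T.graph s := by
  rw [← T.mem_visible_iff, ← Finset.mem_coe, ← Finset.range_orderEmbOfFin _ T.card_visible]
  rfl

theorem visibleVertex_zero (T : PartialUpperTriangulation C) : T.visibleVertex 0 = 0 := by
  obtain ⟨l, hl⟩ := (T.exists_visibleVertex_iff 0).2 ((T.mem_visible_iff 0).1 T.zero_mem)
  exact le_antisymm (hl ▸ T.visibleVertex_strictMono.monotone (Fin.zero_le l)) (Fin.zero_le _)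

theorem visibleVertex_last (T : PartialUpperTriangulation C) :
    T.visibleVertex (Fin.last _) = Fin.last n := by
  obtain ⟨l, hl⟩ := (T.exists_visibleVertex_iff _).2 ((T.mem_visible_iff _).1 T.last_mem)
  exact le_antisymm (Fin.le_last _) (hl ▸ T.visibleVertex_strictMono.monotone (Fin.le_last l))

end PartialUpperTriangulation

section Glue

variable {n₁ n₂ : ℕ} {C₁ : Chain n₁} {C₂ : Chain n₂} (T₁ : PartialUpperTriangulation C₁)
  (T₂ : PartialUpperTriangulation C₂)

theorem glue_inl (x : Fin (T₁.numVisible + 1)) : glue T₁ T₂ (inl x) = inl (T₁.visibleVertex x) := by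
  have : ((inl x : Fin (T₁.numVisible + T₂.numVisible + 1)) : ℕ) ≤ T₁.numVisible := by
    simp only [inl]
    omega
  rw [glue, dif_pos this]
  rfl

theorem glue_inr (y : Fin (T₂.numVisible + 1)) : glue T₁ T₂ (inr y) = inr (T₂.visibleVertex y) := by
  by_cases h : y = 0
  -- `glue` assigns the common index to the first curve, so this case needs the last visible vertex
  -- of `T₁` to coincide with the first of `T₂`.
  · subst h
    rw [← inl_last, glue_inl, T₁.visibleVertex_last, T₂.visibleVertex_zero, inl_last]
  · have hy : (y : ℕ) ≠ 0 := fun e => h (Fin.ext e)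
    have : ¬ ((inr y : Fin (T₁.numVisible + T₂.numVisible + 1)) : ℕ) ≤ T₁.numVisible := by
      simp only [inr]
      omega
    rw [glue, dif_neg this]
    congr 2
    exact Fin.ext (by simp [inr])

theorem glue_strictMono : StrictMono (glue T₁ T₂) := by
  have hl : ∀ {x y : Fin (T₁.numVisible + 1)}, x < y → glue T₁ T₂ (inl x) < glue T₁ T₂ (inl y) :=
    fun h => by
      rw [glue_inl, glue_inl]
      exact inl_strictMono (T₁.visibleVertex_strictMono h)
  have hr : ∀ {x y : Fin (T₂.numVisible + 1)}, x < y → glue T₁ T₂ (inr x) < glue T₁ T₂ (inr y) :=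
    fun h => by
      rw [glue_inr, glue_inr]
      exact inr_strictMono (T₂.visibleVertex_strictMono h)
  intro x y hxy
  rcases le_or_gt (y : ℕ) T₁.numVisible with hy | hy
  · obtain ⟨b, rfl⟩ := exists_inl hy
    obtain ⟨a, rfl⟩ := exists_inl (l := x) ((Fin.lt_def.1 hxy).le.trans hy)
    exact hl (inl_strictMono.lt_iff_lt.1 hxy)
  rcases le_or_gt T₁.numVisible (x : ℕ) with hx | hx
  · obtain ⟨b, rfl⟩ := exists_inr hy.le
    obtain ⟨a, rfl⟩ := exists_inr hx
    exact hr (inr_strictMono.lt_iff_lt.1 hxy)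
  obtain ⟨b, rfl⟩ := exists_inr hy.le
  obtain ⟨a, rfl⟩ := exists_inl hx.le
  refine (hl (y := Fin.last _) hx).trans ?_
  rw [inl_last]
  refine hr (Fin.pos_iff_ne_zero.2 ?_)
  rintro rfl
  simp [inr] at hy

theorem isGlueing_glue :
    IsGlueing inl inr (glue T₁ T₂) (inl (Fin.last _)) T₁.graph T₂.graph := by
  have hm : glue T₁ T₂ (inl (Fin.last _)) = inl (Fin.last n₁) := by
    rw [glue_inl, T₁.visibleVertex_last]
  refine ⟨inl_strictMono, inr_strictMono, glue_strictMono T₁ T₂, fun w => ?_, fun w => ?_,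
    fun a => ?_, fun b => ?_⟩
  · rw [hm]
    refine ⟨fun h => exists_inl h, ?_⟩
    rintro ⟨a, rfl⟩
    exact inl_strictMono.monotone (Fin.le_last a)
  · rw [hm]
    refine ⟨fun h => exists_inr h, ?_⟩
    rintro ⟨a, rfl⟩
    rw [inl_last]
    exact inr_strictMono.monotone (Fin.zero_le a)
  · rw [← T₁.exists_visibleVertex_iff]
    constructor
    · rintro ⟨x, hx⟩
      rcases le_total (x : ℕ) T₁.numVisible with h | h
      · obtain ⟨x, rfl⟩ := exists_inl h
        rw [glue_inl] at hx
        exact ⟨x, inl_strictMono.injective hx⟩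
      -- A vertex of the second curve lying on the first side can only be the common point.
      · obtain ⟨y, rfl⟩ := exists_inr h
        rw [glue_inr] at hx
        have e := congrArg Fin.val hx
        simp only [inl, inr] at e
        exact ⟨Fin.last _, T₁.visibleVertex_last.trans (Fin.ext (by rw [Fin.val_last]; omega))⟩
    · rintro ⟨x, rfl⟩
      exact ⟨inl x, glue_inl T₁ T₂ x⟩
  · rw [← T₂.exists_visibleVertex_iff]
    constructor
    · rintro ⟨x, hx⟩
      rcases le_total (x : ℕ) T₁.numVisible with h | h
      · obtain ⟨x, rfl⟩ := exists_inl h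
        rw [glue_inl] at hx
        have e := congrArg Fin.val hx
        simp only [inl, inr] at e
        exact ⟨0, T₂.visibleVertex_zero.trans (Fin.ext (by rw [Fin.val_zero]; omega))⟩
      · obtain ⟨y, rfl⟩ := exists_inr h
        rw [glue_inr] at hx
        exact ⟨y, inr_strictMono.injective hx⟩
    · rintro ⟨x, rfl⟩
      exact ⟨inr x, glue_inr T₁ T₂ x⟩

end Glue

theorem IsUpperTri.congr {V : Type*} [LinearOrder V] {U U' : V → V → Prop} {G : SimpleGraph V}
    (h : IsUpperTri U G) (hU : ∀ i j, i < j → (U i j ↔ U' i j)) : IsUpperTri U' G :=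
  ⟨fun i j hij hadj => (hU i j hij).1 (h.adm i j hij hadj), h.nonCrossing,
    fun i j hij hUij => h.max i j hij ((hU i j hij).2 hUij)⟩

end ChainTri

/-! ### The bijection -/

open ChainTri
theorem mainTheorem10 {n₁ n₂ : ℕ} (C₁ : Chain n₁) (C₂ : Chain n₂)
    (C : Chain (n₁ + n₂)) (hC : C ≈ C₁.convexSum C₂)
    (D : (v₁ v₂ : ℕ) → Chain (v₁ + v₂))
    (hD : ∀ v₁ v₂, D v₁ v₂ ≈ (Chain.concave v₁).convexSum (Chain.concave v₂)) :
    ∃ f : (Σ (T₁ : PartialUpperTriangulation C₁) (T₂ : PartialUpperTriangulation C₂),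
          PartialUpperTriangulation (D T₁.numVisible T₂.numVisible)) ≃
        PartialUpperTriangulation C,
      ∀ (T₁ : PartialUpperTriangulation C₁) (T₂ : PartialUpperTriangulation C₂)
        (T₃ : PartialUpperTriangulation (D T₁.numVisible T₂.numVisible)),
        (f ⟨T₁, T₂, T₃⟩).graph =
            T₁.graph.map inl ⊔ T₂.graph.map inr ⊔ T₃.graph.map (glue T₁ T₂) ∧
          (f ⟨T₁, T₂, T₃⟩).triangles =
            Finset.image inl '' T₁.triangles ∪ Finset.image inr '' T₂.triangles ∪
              Finset.image (glue T₁ T₂) '' T₃.triangles ∧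
          (f ⟨T₁, T₂, T₃⟩).triangles.ncard =
            T₁.triangles.ncard + T₂.triangles.ncard + T₃.triangles.ncard := by
  have hS : IsSum 1 C₁ C₂ C := (C₁.convexSum_spec C₂).congr hC
  have hSD := fun v₁ v₂ => (Chain.convexSum_spec _ _).congr (hD v₁ v₂)
  have hU₁ := C₁.admissible_of_covBy
  have hU₂ := C₂.admissible_of_covBy
  have hUl := fun i j (hij : i < j) => Chain.admissible_inl_iff hS hij
  have hUr := fun i j (hij : i < j) => Chain.admissible_inr_iff hS hij
  have hU : ∀ (T₁ : PartialUpperTriangulation C₁) (T₂ : PartialUpperTriangulation C₂),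
      ∀ u v, u < glue T₁ T₂ (inl (Fin.last _)) → glue T₁ T₂ (inl (Fin.last _)) < v →
        C.Admissible u v := by
    intro T₁ T₂ u v hu hv
    rw [glue_inl, T₁.visibleVertex_last] at hu hv
    exact Chain.admissible_of_lt_of_gt hS hu hv
  have tri₃ : ∀ {v₁ v₂} (T₃ : PartialUpperTriangulation (D v₁ v₂)),
      IsUpperTri (BridgeOrCovBy (inl (Fin.last v₁))) T₃.graph := fun T₃ =>
    T₃.isUpperTri.congr fun i j hij => Chain.admissible_concave_iff (hSD _ _) hij
  -- The union determines its three parts as restrictions. This yields injectivity and later lets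
  -- the triangle lemmas, stated for restrictions, speak of `T₁`, `T₂`, `T₃`.
  have comaps : ∀ (T₁ : PartialUpperTriangulation C₁) (T₂ : PartialUpperTriangulation C₂)
      (T₃ : PartialUpperTriangulation (D T₁.numVisible T₂.numVisible)) {G},
      G = T₁.graph.map inl ⊔ T₂.graph.map inr ⊔ T₃.graph.map (glue T₁ T₂) →
      G.comap inl = T₁.graph ∧ G.comap inr = T₂.graph ∧ G.comap (glue T₁ T₂) = T₃.graph := by
    rintro T₁ T₂ T₃ G rfl
    have hg := isGlueing_glue T₁ T₂
    exact ⟨hg.comap_l_sup T₁.isUpperTri hU₁ (tri₃ T₃), hg.comap_r_sup T₂.isUpperTri hU₂ (tri₃ T₃),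
      hg.comap_g_sup fun x y => T₃.isUpperTri.adj_of_covBy (Chain.admissible_of_covBy _)⟩
  choose F hF using fun (T : Σ (T₁ : PartialUpperTriangulation C₁)
      (T₂ : PartialUpperTriangulation C₂),
        PartialUpperTriangulation (D T₁.numVisible T₂.numVisible)) =>
    PartialUpperTriangulation.exists_of_isUpperTri <|
      (isGlueing_glue T.1 T.2.1).isUpperTri_sup T.1.isUpperTri hU₁ T.2.1.isUpperTri hU₂
        (tri₃ T.2.2) hUl hUr (hU T.1 T.2.1)
  have hbij : Function.Bijective F := by
    constructor
    · rintro ⟨T₁, T₂, T₃⟩ ⟨T₁', T₂', T₃'⟩ he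
      obtain ⟨h1, h2, h3⟩ := comaps T₁ T₂ T₃ (hF ⟨T₁, T₂, T₃⟩)
      rw [he] at h1 h2 h3
      obtain ⟨h1', h2', h3'⟩ := comaps T₁' T₂' T₃' (hF ⟨T₁', T₂', T₃'⟩)
      -- The order matters: `T₃` and `T₃'`, as well as the two gluing maps, become comparable only
      -- once the first two components are identified.
      obtain rfl := PartialUpperTriangulation.ext_graph (h1.symm.trans h1')
      obtain rfl := PartialUpperTriangulation.ext_graph (h2.symm.trans h2')
      obtain rfl := PartialUpperTriangulation.ext_graph (h3.symm.trans h3')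
      rfl
    · intro T
      obtain ⟨T₁, h1⟩ := PartialUpperTriangulation.exists_of_isUpperTri
        (T.isUpperTri.comap inl_strictMono (fun _ b w _ h2 =>
          exists_inl ((Fin.le_def.1 h2).trans (Nat.lt_succ_iff.1 b.2))) hUl)
      obtain ⟨T₂, h2⟩ := PartialUpperTriangulation.exists_of_isUpperTri
        (T.isUpperTri.comap inr_strictMono (fun a _ w h1 _ =>
          exists_inr ((Nat.le_add_right _ _).trans (Fin.le_def.1 h1))) hUr)
      have hg := isGlueing_glue T₁ T₂
      have q1 := T₁.isUpperTri
      have q2 := T₂.isUpperTri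
      rw [h1, h2] at hg
      rw [h1] at q1
      rw [h2] at q2
      -- The third component restricts the graph of `T` to the concatenated visible curve of the
      -- `T₁` and `T₂` already found.
      obtain ⟨T₃, h3⟩ := PartialUpperTriangulation.exists_of_isUpperTri (C := D _ _)
        ((hg.isUpperTri_comap T.isUpperTri q1 hU₁ q2 hU₂ (hU T₁ T₂)).congr
          fun i j hij => (Chain.admissible_concave_iff (hSD _ _) hij).symm)
      refine ⟨⟨T₁, T₂, T₃⟩, PartialUpperTriangulation.ext_graph ?_⟩
      rw [hF, h1, h2, h3, hg.sup_comap T.isUpperTri.nonCrossing]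
  refine ⟨Equiv.ofBijective F hbij, fun T₁ T₂ T₃ => ?_⟩
  rw [Equiv.ofBijective_apply]
  have hgr := hF ⟨T₁, T₂, T₃⟩
  have hg := isGlueing_glue T₁ T₂
  obtain ⟨h1, h2, h3⟩ := comaps T₁ T₂ T₃ hgr
  rw [← h1, ← h2] at hg
  have hnc := (F ⟨T₁, T₂, T₃⟩).isUpperTri.nonCrossing
  refine ⟨hgr, ?_, ?_⟩
  · have := hg.cliqueSet_three hnc
    rw [h1, h2, h3] at this
    unfold PartialUpperTriangulation.triangles
    convert this
  · have := hg.ncard_cliqueSet_three hnc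
    rwa [h1, h2, h3] at this
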